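/- Hypergraphs are finite, and multiple copies of a hyperedge are allowed. A $3$-hypergraph is a hypergraph $H$ with nonempty vertex set $V$ each of whose hyperedges has cardinality $2$ or $3$; a $3$-hyperedge is a hyperedge of cardinality $3$. $H$ is connected if for every nonempty proper subset $X\subset V$ some hyperedge intersects both $X$ and $V\setminus X$. An edge-cut of a connected $H$ is an inclusionwise minimal set $F$ of hyperedges such that $H-F$ is disconnected. $H$ is $k$-edge-connected if it is connected and has no edge-cut of cardinality less than $k$. A quasigraph $\pi$ in $H$ assigns to each hyperedge $e$ of $H$ a set $\pi(e)\subseteq e$ that is either empty or of cardinality $2$; $e$ is used by $\pi$ if $\pi(e)\neq\emptyset$, and $E(\pi)$ is the set of used hyperedges. The nonempty sets $\pi(e)$, taken with multiplicity as edges, form a (multi)graph $\pi^*$ on the vertex set $V$; $\pi$ is a quasitree if $\pi^*$ is a tree. The complement $\overline\pi$ is the hypergraph on $V$ formed by the hyperedges of $H$ not used by $\pi$. For $X\subseteq V$, the $\pi$-section $H[X]^\pi$ is the hypergraph with vertex set $X$ whose hyperedges are the sets $e\cap X$ (one copy for each $e$), where $e$ is a hyperedge of $H$ with $|e\cap X|\ge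 2$ and $\pi(e)\subseteq X$; the induced quasigraph $\pi[X]$ in $H[X]^\pi$ is given by $\pi[X](e\cap X)=\pi(e)$. Recursively, $\pi$ has tight complement in $H$ if (a) $\overline\pi$ is connected, or (b) there is a partition $V=X_1\cup X_2$ into two nonempty sets such that, for $i=1,2$, $\pi[X_i]$ has tight complement in $H[X_i]^\pi$, and there is a hyperedge $e\in E(\pi)$ with $\pi(e)\subseteq X_1$ and $e\cap X_2\neq\emptyset$. Theorem. Let $H$ be a $4$-edge-connected $3$-hypergraph. If no $3$-hyperedge of $H$ is included in any edge-cut of size $4$, then $H$ contains a quasitree with tight complement (in $H$). -/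

import Mathlib

/-- A finite 3-hypergraph: a finite vertex set, a finite set of hyperedge labels, and for each label
`e` the set `inc e` of vertices of that hyperedge, of cardinality 2 or 3. Distinct labels may have
the same vertex set, so multiple copies of a hyperedge are allowed. The value of `inc` outside
`edges` plays no role. -/
structure ThreeHypergraph (V E : Type*) where
  verts : Finset V
  edges : Finset E
  inc : E → Finset V
  inc_subset : ∀ e ∈ edges, inc e ⊆ verts
  card_inc : ∀ e ∈ edges, (inc e).card = 2 ∨ (inc e).card = 3

namespace ThreeHypergraph

/-- For every nonempty proper subset `X` of the vertex set, some hyperedge intersects both `X` and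
its complement. -/
def Connected {V E : Type*} [DecidableEq V] (H : ThreeHypergraph V E) : Prop :=
  ∀ X : Finset V, X ⊂ H.verts → X.Nonempty →
    ∃ e ∈ H.edges, (H.inc e ∩ X).Nonempty ∧ (H.inc e ∩ (H.verts \ X)).Nonempty

/-- The spanning subhypergraph `H - F`. -/
def deleteEdges {V E : Type*} [DecidableEq E] (H : ThreeHypergraph V E) (F : Finset E) :
    ThreeHypergraph V E where
  verts := H.verts
  edges := H.edges \ F
  inc := H.inc
  inc_subset e he := H.inc_subset e (Finset.mem_sdiff.1 he).1
  card_inc e he := H.card_inc e (Finset.mem_sdiff.1 he).1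

/-- An edge-cut of a (connected) hypergraph: an inclusionwise minimal set `F` of hyperedges such
that `H - F` is disconnected. -/
def IsEdgeCut {V E : Type*} [DecidableEq V] [DecidableEq E] (H : ThreeHypergraph V E)
    (F : Finset E) : Prop :=
  Minimal (fun F' : Finset E => F' ⊆ H.edges ∧ ¬ (H.deleteEdges F').Connected) F

/-- `H` is connected and has no edge-cut of cardinality less than `k`. -/
def EdgeConnected {V E : Type*} [DecidableEq V] [DecidableEq E] (H : ThreeHypergraph V E)
    (k : ℕ) : Prop :=
  H.Connected ∧ ∀ F : Finset E, H.IsEdgeCut F → k ≤ F.card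

end ThreeHypergraph

/-- A quasigraph in `H`: to each hyperedge `e` it assigns a subset of `e` which is either empty or
of cardinality 2. The value of `rep` outside `H.edges` plays no role. -/
structure Quasigraph {V E : Type*} (H : ThreeHypergraph V E) where
  rep : E → Finset V
  rep_subset : ∀ e ∈ H.edges, rep e ⊆ H.inc e
  card_rep : ∀ e ∈ H.edges, rep e = ∅ ∨ (rep e).card = 2

namespace Quasigraph

/-- The set `E(π)` of the hyperedges used by `π`. -/
def used {V E : Type*} [DecidableEq V] {H : ThreeHypergraph V E} (π : Quasigraph H) : Finset E :=
  H.edges.filter (fun e => π.rep e ≠ ∅)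

/-- The simple graph underlying the multigraph `π*` on the vertex set of `H`, whose edges are the
nonempty sets `π(e)`. -/
def starGraph {V E : Type*} [DecidableEq V] {H : ThreeHypergraph V E} (π : Quasigraph H) :
    SimpleGraph {v : V // v ∈ H.verts} where
  Adj x y := x ≠ y ∧ ∃ e ∈ H.edges, π.rep e = {x.1, y.1}
  symm := ⟨fun x y h => ⟨h.1.symm, by
    obtain ⟨e, he, h2⟩ := h.2
    exact ⟨e, he, by rw [h2, Finset.pair_comm]⟩⟩⟩
  loopless := ⟨fun _ h => h.1 rfl⟩

/-- `π` is a quasitree if the multigraph `π*` is a tree: it has no parallel edges (distinct used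
hyperedges have distinct representations), and its underlying simple graph is a tree. -/
def IsQuasitree {V E : Type*} [DecidableEq V] {H : ThreeHypergraph V E} (π : Quasigraph H) :
    Prop :=
  (∀ e ∈ π.used, ∀ f ∈ π.used, π.rep e = π.rep f → e = f) ∧ π.starGraph.IsTree

/-- The complement of `π`: the spanning subhypergraph formed by the hyperedges not used by `π`. -/
def complement {V E : Type*} [DecidableEq V] [DecidableEq E] {H : ThreeHypergraph V E}
    (π : Quasigraph H) : ThreeHypergraph V E :=
  H.deleteEdges π.used

/-- The `π`-section of `H` at `X`: its vertex set is `X`, and its hyperedges are the sets `e ∩ X`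
for the hyperedges `e` of `H` such that `|e ∩ X| ≥ 2` and `π(e) ⊆ X`. The hyperedge `e ∩ X` keeps
the label `e`. -/
def sectionAt {V E : Type*} [DecidableEq V] {H : ThreeHypergraph V E} (π : Quasigraph H)
    (X : Finset V) : ThreeHypergraph V E where
  verts := X
  edges := H.edges.filter (fun e => 2 ≤ (H.inc e ∩ X).card ∧ π.rep e ⊆ X)
  inc e := H.inc e ∩ X
  inc_subset _ _ := Finset.inter_subset_right
  card_inc e he := by
    obtain ⟨h1, h2, -⟩ := Finset.mem_filter.1 he
    have h3 := Finset.card_le_card (Finset.inter_subset_left (s₁ := H.inc e) (s₂ := X))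
    have h4 := H.card_inc e h1
    omega

/-- The quasigraph `π[X]` induced by `π` on `X`, in the `π`-section of `H` at `X`; its value at
`e ∩ X` is `π(e)`. -/
def induce {V E : Type*} [DecidableEq V] {H : ThreeHypergraph V E} (π : Quasigraph H)
    (X : Finset V) : Quasigraph (π.sectionAt X) where
  rep := π.rep
  rep_subset e he := by
    obtain ⟨h1, -, h2⟩ := Finset.mem_filter.1 he
    exact Finset.subset_inter (π.rep_subset e h1) h2
  card_rep e he := π.card_rep e (Finset.mem_filter.1 he).1

/-- `π` has tight complement in `H`: either the complement of `π` is connected, or the vertex set is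
partitioned into two nonempty sets `X₁`, `X₂` such that each `π[Xᵢ]` has tight complement in the
`π`-section at `Xᵢ`, and some used hyperedge `e` has `π(e) ⊆ X₁` and intersects `X₂`. -/
inductive HasTightComplement {V E : Type*} [DecidableEq V] [DecidableEq E] :
    (H : ThreeHypergraph V E) → Quasigraph H → Prop
  | of_connected (H : ThreeHypergraph V E) (π : Quasigraph H) (h : π.complement.Connected) :
      HasTightComplement H π
  | of_partition (H : ThreeHypergraph V E) (π : Quasigraph H) (X₁ X₂ : Finset V)
      (hunion : X₁ ∪ X₂ = H.verts) (hdisj : Disjoint X₁ X₂)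
      (hne₁ : X₁.Nonempty) (hne₂ : X₂.Nonempty)
      (h₁ : HasTightComplement (π.sectionAt X₁) (π.induce X₁))
      (h₂ : HasTightComplement (π.sectionAt X₂) (π.induce X₂))
      (hlink : ∃ e ∈ π.used, π.rep e ⊆ X₁ ∧ (H.inc e ∩ X₂).Nonempty) :
      HasTightComplement H π

end Quasigraph

/-!
Partitions of the vertex set are equivalence relations (`Setoid`), ordered by refinement. Call `π`
*anticonnected* if every nontrivial partition is crossed by a hyperedge `e` such that `π e` lies
inside a class. An anticonnected quasigraph has tight complement: start from the components of the
complement and repeatedly merge two classes by means of a used hyperedge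
(`Quasigraph.hasTightComplement_of_partitions`). So a spanning tree `π` that is anticonnected has to
be found.

By `QuasitreePacking.exists_skeletal`, every 3-hypergraph has an acyclic quasigraph `π` and a
partition `L` such that `π` is connected and anticonnected on each class of `L`, while the
hyperedges `g` for which `π g` does not cross `L` form an acyclic hypergraph on the classes. If `L`
had `n ≥ 2` classes, then the edges `π g` that cross `L` would form a forest on the classes, as
would the remaining crossing hyperedges. Hence the incidences between classes and crossing
hyperedges would number at most `4 (n - 1) + t`, where `t` is the number of hyperedges that meet
three classes and have `π g` crossing `L`. But each class is incident with at least four crossing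
hyperedges, and with at least five if it meets one of these `t` hyperedges. Since the latter induce
a forest on the classes that they meet, there are at least `t` such classes, so the number of
incidences is at least `4 n + t`, a contradiction (`QuasitreePacking.eq_top_of_skeletal`).

The partition `L` is the end of a sequence of refinements, starting from the trivial partition, in
which the classes are split alternately into the components and the anticomponents of `π`. Each
refinement is chosen as coarse as possible among all acyclic quasigraphs that took the same course
before. Suppose that the sequence has come to rest, and that there is a cycle of hyperedges `g` with
`π g` not crossing the present partition `L`. Choose the cycle such that it stays inside the classes
of the partitions in the sequence for as long as possible, and let `P` be the last of these
partitions. Some hyperedge `e` of the cycle crosses the next partition, at two vertices `u` and `w`.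
If some `π` is connected and anticonnected on the classes of `L` even without `e`, then the rest of
the cycle shows that `e` may be used as the edge `uw` without spoiling the anticonnectedness at any
earlier stage; after removing a suitable edge of the cycle of `π + uw`, if there is one, one obtains
an acyclic quasigraph which improves one of the optimal choices
(`QuasitreePacking.Configuration.false`). Otherwise `e` is *reserved*: the process goes on with `e`
not being available inside the classes, after restriction to the quasigraphs that do not cross `L`
at the hyperedges at which `π` does not. Only one class is affected; it contains exactly two
vertices of `e`, and these are separated at once. Hence no class contains two vertices of a reserved
hyperedge when the next one is reserved.
-/

/-! ### Gluing equivalence relations along sets -/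

namespace QuasitreePacking

variable {V E : Type*}

theorem finite_setoid [Finite V] : Finite (Setoid V) :=
  Finite.of_injective (fun s : Setoid V => fun x y => s x y) fun s t h =>
    Setoid.ext fun x y => by simpa using congrFun (congrFun h x) y

/-- The equivalence relation obtained from `s` by merging all the classes that meet `T`. -/
def joinSet (s : Setoid V) (T : Set V) : Setoid V where
  r x y := s x y ∨ ((∃ a ∈ T, s x a) ∧ ∃ b ∈ T, s y b)
  iseqv := by
    refine ⟨fun x => Or.inl (s.refl' x), ?_, ?_⟩
    · rintro x y (h | ⟨h, h'⟩)
      · exact Or.inl (s.symm' h)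
      · exact Or.inr ⟨h', h⟩
    · rintro x y z (h | ⟨h, h'⟩) (k | ⟨k, k'⟩)
      · exact Or.inl (s.trans' h k)
      · obtain ⟨a, ha, hya⟩ := k
        exact Or.inr ⟨⟨a, ha, s.trans' h hya⟩, k'⟩
      · obtain ⟨a, ha, hya⟩ := h'
        exact Or.inr ⟨h, ⟨a, ha, s.trans' (s.symm' k) hya⟩⟩
      · exact Or.inr ⟨h, k'⟩

theorem joinSet_apply {s : Setoid V} {T : Set V} {x y : V} :
    joinSet s T x y ↔ s x y ∨ ((∃ a ∈ T, s x a) ∧ ∃ b ∈ T, s y b) := Iff.rfl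

theorem le_joinSet (s : Setoid V) (T : Set V) : s ≤ joinSet s T := fun _ _ h => Or.inl h

theorem joinSet_of_mem {s : Setoid V} {T : Set V} {x y : V} (hx : x ∈ T) (hy : y ∈ T) :
    joinSet s T x y := Or.inr ⟨⟨x, hx, s.refl' x⟩, ⟨y, hy, s.refl' y⟩⟩

/-- The least equivalence relation that contains `L` and relates any two elements of the same set
`T g`, for `g ∈ D`, that are related by `Q`. Thus each set `T g` is first cut into its traces on the
classes of `Q`, and `L` is then glued along these traces. -/
def glue (T : E → Finset V) (L Q : Setoid V) (D : Set E) : Setoid V :=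
  sInf {R | L ≤ R ∧ ∀ g ∈ D, ∀ x ∈ T g, ∀ y ∈ T g, Q x y → R x y}

section glue

variable {T T' : E → Finset V} {L L' Q Q' R : Setoid V} {D D' : Set E}

theorem le_glue : L ≤ glue T L Q D := le_sInf fun _ hR => hR.1

theorem glue_of_mem {g : E} (hg : g ∈ D) {x y : V} (hx : x ∈ T g) (hy : y ∈ T g) (hQ : Q x y) :
    glue T L Q D x y := Setoid.sInf_iff.2 fun _ hR => hR.2 g hg x hx y hy hQ

theorem glue_le (hL : L ≤ R) (h : ∀ g ∈ D, ∀ x ∈ T g, ∀ y ∈ T g, Q x y → R x y) :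
    glue T L Q D ≤ R := sInf_le ⟨hL, h⟩

theorem glue_mono (hL : L ≤ L') (hQ : Q ≤ Q') (hD : D ⊆ D') : glue T L Q D ≤ glue T L' Q' D' :=
  glue_le (hL.trans le_glue) fun _ hg _ hx _ hy h => glue_of_mem (hD hg) hx hy (hQ h)

theorem glue_insert_le {f : E} {S : Set V}
    (hS : ∀ x ∈ T f, ∀ y ∈ T f, Q x y → x = y ∨ (x ∈ S ∧ y ∈ S)) :
    glue T L Q (insert f D) ≤ joinSet (glue T L Q D) S := by
  refine glue_le (le_glue.trans (le_joinSet _ _)) ?_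
  rintro g (rfl | hg) x hx y hy h
  · rcases hS x hx y hy h with rfl | ⟨h1, h2⟩
    · exact Setoid.refl' _ x
    · exact joinSet_of_mem h1 h2
  · exact le_joinSet _ _ (glue_of_mem hg hx hy h)

end glue

/-! ### Quasigraphs and the two refinements of a partition -/

/-- The assignment `π` is a quasigraph in the hypergraph with hyperedges `inc g`. -/
structure IsQuasi (inc π : E → Finset V) : Prop where
  subset : ∀ g, π g ⊆ inc g
  card : ∀ g, π g = ∅ ∨ (π g).card = 2

/-- The multigraph with edges `π g` is a forest: the ends of each edge are not connected by the
other edges. -/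
def Acyclic (π : E → Finset V) : Prop :=
  ∀ g, ∀ a ∈ π g, ∀ b ∈ π g, a ≠ b → ¬ glue π ⊥ ⊤ {g}ᶜ a b

/-- The refinement of the partition `P` into the vertex sets of the components of the graphs formed,
inside each class of `P`, by the edges `π g` with `g ∉ F`. -/
def treeRefine (F : Set E) (P : Setoid V) (π : E → Finset V) : Setoid V := glue π ⊥ P Fᶜ

/-- A refinement `R` of `P` is anticlosed if, for a class `X` of `P`, a hyperedge `g ∉ F` with
`π g ⊆ X` meets `X` in at least two classes of `R` only if `π g` does so. -/
def AntiClosed (inc : E → Finset V) (F : Set E) (P : Setoid V) (π : E → Finset V) (R : Setoid V) :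
    Prop :=
  R ≤ P ∧ ∀ g ∉ F, ∀ x ∈ inc g, ∀ y ∈ inc g, P x y → (∀ a ∈ π g, P a x) →
    (∀ a ∈ π g, ∀ b ∈ π g, R a b) → R x y

/-- The finest anticlosed refinement of `P`; its classes are the anticomponents of `π` in the
classes of `P`, computed without the hyperedges in `F`. -/
def antiRefine (inc : E → Finset V) (F : Set E) (P : Setoid V) (π : E → Finset V) : Setoid V :=
  sInf {R | AntiClosed inc F P π R}

section refine

variable {inc π : E → Finset V} {F F' : Set E} {P P' R : Setoid V}

theorem treeRefine_le : treeRefine F P π ≤ P := glue_le bot_le fun _ _ _ _ _ _ h => h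

theorem treeRefine_mono (hF : F' ⊆ F) (hP : P ≤ P') : treeRefine F P π ≤ treeRefine F' P' π :=
  glue_mono le_rfl hP (Set.compl_subset_compl.2 hF)

theorem treeRefine_of_mem {g : E} (hg : g ∉ F) {a b : V} (ha : a ∈ π g) (hb : b ∈ π g)
    (h : P a b) : treeRefine F P π a b := glue_of_mem hg ha hb h

theorem treeRefine_le_of (h : ∀ g ∉ F, ∀ a ∈ π g, ∀ b ∈ π g, P a b → R a b) :
    treeRefine F P π ≤ R := glue_le bot_le h

theorem AntiClosed.antiRefine_le (h : AntiClosed inc F P π R) : antiRefine inc F P π ≤ R :=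
  sInf_le h

theorem antiRefine_le : antiRefine inc F P π ≤ P :=
  sInf_le ⟨le_rfl, fun _ _ _ _ _ _ h _ _ => h⟩

theorem antiClosed_antiRefine : AntiClosed inc F P π (antiRefine inc F P π) := by
  refine ⟨antiRefine_le, fun g hg x hx y hy h ha hab => Setoid.sInf_iff.2 fun R hR => ?_⟩
  exact hR.2 g hg x hx y hy h ha fun a ha b hb => Setoid.sInf_iff.1 (hab a ha b hb) R hR

theorem IsQuasi.pair (h : IsQuasi inc π) {g : E} {a : V} (ha : a ∈ π g) : ∃ b ∈ π g, a ≠ b := by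
  rcases h.card g with h0 | h2
  · simp [h0] at ha
  · obtain ⟨b, hb, hab⟩ := Finset.exists_mem_ne (by omega : 1 < (π g).card) a
    exact ⟨b, hb, hab.symm⟩

theorem IsQuasi.eq_pair [DecidableEq V] (h : IsQuasi inc π) {g : E} {a b : V} (ha : a ∈ π g)
    (hb : b ∈ π g) (hab : a ≠ b) : π g = {a, b} := by
  have hcard := (h.card g).resolve_left fun h0 => by simp [h0] at ha
  refine (Finset.eq_of_subset_of_card_le ?_ (by rw [hcard, Finset.card_pair hab])).symm
  intro z hz
  simp only [Finset.mem_insert, Finset.mem_singleton] at hz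
  rcases hz with rfl | rfl <;> assumption

/-- A relation between the two elements of `π g` holds for all pairs of elements of `π g`. -/
theorem IsQuasi.rel_of_pair (h : IsQuasi inc π) {g : E} {a b : V} (ha : a ∈ π g)
    (hb : b ∈ π g) (hab : a ≠ b) (hR : R a b) : ∀ x ∈ π g, ∀ y ∈ π g, R x y := by
  classical
  rw [h.eq_pair ha hb hab]
  intro x hx y hy
  simp only [Finset.mem_insert, Finset.mem_singleton] at hx hy
  rcases hx with rfl | rfl <;> rcases hy with rfl | rfl
  exacts [R.refl' _, hR, R.symm' hR, R.refl' _]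

/-- Two pairs in a set of at most three elements intersect. -/
theorem pairs_meet {S : Finset V} (hS : S.card ≤ 3) {a b x y : V} (ha : a ∈ S) (hb : b ∈ S)
    (hx : x ∈ S) (hy : y ∈ S) (hab : a ≠ b) (hxy : x ≠ y) : a = x ∨ a = y ∨ b = x ∨ b = y := by
  classical
  by_contra! h
  obtain ⟨h1, h2, h3, h4⟩ := h
  have hsub : ({a, b, x, y} : Finset V) ⊆ S := by
    intro z; simp only [Finset.mem_insert, Finset.mem_singleton]
    rintro (rfl | rfl | rfl | rfl) <;> assumption
  have hcard : ({a, b, x, y} : Finset V).card = 4 := by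
    rw [Finset.card_insert_of_notMem (by simp [*]), Finset.card_insert_of_notMem (by simp [*]),
      Finset.card_pair hxy]
  have := Finset.card_le_card hsub
  omega

/-- If `π g` lies inside a class of `P` and two vertices of `g` are in the same class of `P`, then
it is the same class. -/
theorem IsQuasi.rep_near (h : IsQuasi inc π) {g : E} (h3 : (inc g).card ≤ 3) {x y : V}
    (hx : x ∈ inc g) (hy : y ∈ inc g) (hne : x ≠ y) (hxy : P x y)
    (hab : ∀ a ∈ π g, ∀ b ∈ π g, P a b) : ∀ a ∈ π g, P a x := by
  intro a ha
  obtain ⟨b, hb, hne'⟩ := h.pair ha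
  rcases pairs_meet h3 (h.subset g ha) (h.subset g hb) hx hy hne' hne with rfl | rfl | rfl | rfl
  · exact P.refl' _
  · exact P.symm' hxy
  · exact hab _ ha _ hb
  · exact P.trans' (hab _ ha _ hb) (P.symm' hxy)

end refine

/-! ### Adding an edge to a quasigraph and removing another one -/

section exchange

variable [DecidableEq V]

open scoped Classical in
/-- The assignment obtained from `π` by using the hyperedge `e` as the edge `uw` and by not using
the hyperedges in `D`. -/
noncomputable def exch (π : E → Finset V) (e : E) (u w : V) (D : Set E) : E → Finset V :=
  fun g => if g = e then {u, w} else if g ∈ D then ∅ else π g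

variable {inc π : E → Finset V} {e : E} {u w : V} {D : Set E} {F : Set E} {P : Setoid V}

theorem exch_self : exch π e u w D e = {u, w} := by simp [exch]

theorem exch_of_mem {g : E} (hg : g ∈ D) (hne : g ≠ e) : exch π e u w D g = ∅ := by
  simp [exch, hg, hne]

theorem exch_of_notMem {g : E} (hg : g ∉ D) (hne : g ≠ e) : exch π e u w D g = π g := by
  simp [exch, hg, hne]

theorem IsQuasi.exch (h : IsQuasi inc π) (hu : u ∈ inc e) (hw : w ∈ inc e) (hne : u ≠ w) :
    IsQuasi inc (exch π e u w D) := by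
  refine ⟨fun g => ?_, fun g => ?_⟩ <;> by_cases hg : g = e
  · subst hg
    rw [exch_self]
    intro z; simp only [Finset.mem_insert, Finset.mem_singleton]
    rintro (rfl | rfl) <;> assumption
  · by_cases hD : g ∈ D
    · simp [exch_of_mem hD hg]
    · rw [exch_of_notMem hD hg]; exact h.subset g
  · subst hg
    rw [exch_self, Finset.card_pair hne]; exact Or.inr rfl
  · by_cases hD : g ∈ D
    · simp [exch_of_mem hD hg]
    · rw [exch_of_notMem hD hg]; exact h.card g

/-- A property of pairs that holds for `u, w` and for the pairs in the sets `π g` with `g ∉ D` holds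
for all the pairs in the sets `exch π e u w D g`. -/
theorem exch_pairs {R : Setoid V} (hR : R u w) {g : E}
    (h : g ≠ e → g ∉ D → ∀ a ∈ π g, ∀ b ∈ π g, R a b) :
    ∀ a ∈ exch π e u w D g, ∀ b ∈ exch π e u w D g, R a b := by
  by_cases hg : g = e
  · subst hg
    rw [exch_self]
    intro a ha b hb
    simp only [Finset.mem_insert, Finset.mem_singleton] at ha hb
    rcases ha with rfl | rfl <;> rcases hb with rfl | rfl
    exacts [R.refl' _, hR, R.symm' hR, R.refl' _]
  · by_cases hD : g ∈ D
    · simp [exch_of_mem hD hg]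
    · rw [exch_of_notMem hD hg]; exact h hg hD

theorem Acyclic.exch (h : Acyclic π) (he : π e = ∅) (hD : ¬ glue π ⊥ ⊤ Dᶜ u w) :
    Acyclic (exch π e u w D) := by
  intro g a ha b hb hab hglue
  by_cases hg : g = e
  · subst hg
    have hle : glue (QuasitreePacking.exch π g u w D) ⊥ ⊤ {g}ᶜ ≤ glue π ⊥ ⊤ Dᶜ := by
      refine glue_le bot_le fun g' hg' x hx y hy _ => ?_
      by_cases hgD : g' ∈ D
      · simp [exch_of_mem hgD hg'] at hx
      · rw [exch_of_notMem hgD hg'] at hx hy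
        exact glue_of_mem hgD hx hy trivial
    rw [exch_self] at ha hb
    have hab' := hle hglue
    simp only [Finset.mem_insert, Finset.mem_singleton] at ha hb
    rcases ha with rfl | rfl <;> rcases hb with rfl | rfl
    exacts [hab rfl, hD hab', hD (Setoid.symm' _ hab'), hab rfl]
  · have hgD : g ∉ D := fun hgD => by simp [exch_of_mem hgD hg] at ha
    rw [exch_of_notMem hgD hg] at ha hb
    have hle : glue (QuasitreePacking.exch π e u w D) ⊥ ⊤ {g}ᶜ
        ≤ joinSet (glue π ⊥ ⊤ (D ∪ {g})ᶜ) {u, w} := by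
      refine glue_le bot_le fun g' hg' x hx y hy _ => ?_
      refine exch_pairs (joinSet_of_mem (by simp) (by simp)) ?_ x hx y hy
      intro _ hD' a ha b hb
      refine le_joinSet _ _ (glue_of_mem ?_ ha hb trivial)
      exact fun h => h.elim hD' hg'
    have h1 : glue π ⊥ ⊤ (D ∪ {g})ᶜ ≤ glue π ⊥ ⊤ {g}ᶜ :=
      glue_mono le_rfl le_rfl (Set.compl_subset_compl.2 Set.subset_union_right)
    have h2 : glue π ⊥ ⊤ (D ∪ {g})ᶜ ≤ glue π ⊥ ⊤ Dᶜ :=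
      glue_mono le_rfl le_rfl (Set.compl_subset_compl.2 Set.subset_union_left)
    have h3 : glue π ⊥ ⊤ Dᶜ a b := glue_of_mem hgD ha hb trivial
    rcases hle hglue with hs | ⟨⟨p, hp, hap⟩, q, hq, hbq⟩
    · exact h g a ha b hb hab (h1 hs)
    · simp only [Set.mem_insert_iff, Set.mem_singleton_iff] at hp hq
      have h4 : p = q → False := by
        rintro rfl
        exact h g a ha b hb hab (h1 (Setoid.trans' _ hap (Setoid.symm' _ hbq)))
      have h5 : glue π ⊥ ⊤ Dᶜ p q :=
        Setoid.trans' _ (Setoid.symm' _ (h2 hap)) (Setoid.trans' _ h3 (h2 hbq))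
      rcases hp with rfl | rfl <;> rcases hq with rfl | rfl
      exacts [h4 rfl, hD h5, hD (Setoid.symm' _ h5), h4 rfl]

/-- A refinement into components is not made finer by the exchange, provided that the vertices of
each removed edge stay connected. -/
theorem treeRefine_le_exch (he : π e = ∅)
    (hD : ∀ f ∈ D, ∀ a ∈ π f, ∀ b ∈ π f, treeRefine F P (exch π e u w D) a b) :
    treeRefine F P π ≤ treeRefine F P (exch π e u w D) := by
  refine treeRefine_le_of fun g hg a ha b hb hab => ?_
  by_cases hgD : g ∈ D
  · exact hD g hgD a ha b hb
  · have hge : g ≠ e := by rintro rfl; simp [he] at ha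
    refine treeRefine_of_mem hg ?_ ?_ hab <;> rwa [exch_of_notMem hgD hge]

theorem exch_treeRefine_le (huw : treeRefine F P π u w) :
    treeRefine F P (exch π e u w D) ≤ treeRefine F P π := by
  refine treeRefine_le_of fun g hg a ha b hb hab => ?_
  by_cases hge : g = e
  · exact exch_pairs huw (fun h => absurd hge h) a ha b hb
  · by_cases hgD : g ∈ D
    · simp [exch_of_mem hgD hge] at ha
    · rw [exch_of_notMem hgD hge] at ha hb
      exact treeRefine_of_mem hg ha hb hab

theorem exch_antiRefine_le (h3 : ∀ g, (inc g).card ≤ 3) (hπ : IsQuasi inc π) (he : π e = ∅)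
    (hD : ∀ f ∈ D, ∀ a ∈ π f, ∀ b ∈ π f, antiRefine inc F P π a b) :
    antiRefine inc F P (exch π e u w D) ≤ antiRefine inc F P π := by
  have hcl := antiClosed_antiRefine (inc := inc) (F := F) (P := P) (π := π)
  refine AntiClosed.antiRefine_le ⟨hcl.1, fun g hg x hx y hy hxy ha hab => ?_⟩
  by_cases hne : x = y
  · subst hne; exact Setoid.refl' _ x
  by_cases hge : g = e
  · exact hcl.2 g hg x hx y hy hxy (by simp [hge, he]) (by simp [hge, he])
  by_cases hgD : g ∈ D
  · exact hcl.2 g hg x hx y hy hxy (hπ.rep_near (h3 g) hx hy hne hxy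
      fun a ha b hb => hcl.1 (hD g hgD a ha b hb)) (hD g hgD)
  · rw [exch_of_notMem hgD hge] at ha hab
    exact hcl.2 g hg x hx y hy hxy ha hab

/-- A refinement into anticomponents is not made finer by the exchange if `u` and `w` are connected
through classes of `L` in which `π` is anticonnected without `e`, and through hyperedges `g ≠ e` in
a set `C` none of whose sets `π g` crosses `L`. -/
theorem antiRefine_le_exch (h3 : ∀ g, (inc g).card ≤ 3) {L Q : Setoid V} {F' C : Set E}
    (hπ : IsQuasi inc π)
    (hL : antiRefine inc (insert e F') L π = L) (hF : F ⊆ F') (hLP : L ≤ P) (hQP : Q ≤ P)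
    (hC : ∀ g ∈ C, ∀ a ∈ π g, ∀ b ∈ π g, L a b)
    (hCF : ∀ g ∈ C, ∀ x ∈ inc g, ∀ y ∈ inc g, x ≠ y → Q x y → g ∉ F)
    (hu : u ∈ inc e) (hw : w ∈ inc e) (hne : u ≠ w) (huw : Q u w)
    (hglue : glue inc L Q (C \ {e}) u w) :
    antiRefine inc F P π ≤ antiRefine inc F P (exch π e u w D) := by
  have hcl := antiClosed_antiRefine (inc := inc) (F := F) (P := P) (π := exch π e u w D)
  set R := antiRefine inc F P (exch π e u w D) with hR
  have hLR : L ≤ R := by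
    have : AntiClosed inc (insert e F') L π (R ⊓ L) := by
      refine ⟨inf_le_right, fun g hg x hx y hy hxy ha hab => ⟨?_, hxy⟩⟩
      rw [Set.mem_insert_iff, not_or] at hg
      refine hcl.2 g (fun h => hg.2 (hF h)) x hx y hy (hLP hxy) ?_ ?_ <;>
        by_cases hgD : g ∈ D
      · simp [exch_of_mem hgD hg.1]
      · rw [exch_of_notMem hgD hg.1]; exact fun a h => hLP (ha a h)
      · simp [exch_of_mem hgD hg.1]
      · rw [exch_of_notMem hgD hg.1]; exact fun a h b h' => (hab a h b h').1
    exact (hL.ge.trans this.antiRefine_le).trans inf_le_left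
  have hRuw : R u w := by
    refine (glue_le hLR fun g hg x hx y hy hxy => ?_ : glue inc L Q (C \ {e}) ≤ R) hglue
    by_cases hne' : x = y
    · subst hne'; exact Setoid.refl' _ x
    have hgF := hCF g hg.1 x hx y hy hne' hxy
    by_cases hgD : g ∈ D
    · exact hcl.2 g hgF x hx y hy (hQP hxy) (by simp [exch_of_mem hgD hg.2])
        (by simp [exch_of_mem hgD hg.2])
    · refine hcl.2 g hgF x hx y hy (hQP hxy) ?_ ?_ <;> rw [exch_of_notMem hgD hg.2]
      · exact hπ.rep_near (h3 g) hx hy hne' (hQP hxy) fun a ha b hb => hLP (hC g hg.1 a ha b hb)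
      · exact fun a ha b hb => hLR (hC g hg.1 a ha b hb)
  refine AntiClosed.antiRefine_le ⟨hcl.1, fun g hg x hx y hy hxy ha hab => ?_⟩
  by_cases hne' : x = y
  · subst hne'; exact Setoid.refl' _ x
  by_cases hge : g = e
  · subst hge
    exact hcl.2 g hg x hx y hy hxy
      ((hπ.exch hu hw hne).rep_near (h3 g) hx hy hne' hxy
        (exch_pairs (hQP huw) fun h => absurd rfl h))
      (exch_pairs hRuw fun h => absurd rfl h)
  by_cases hgD : g ∈ D
  · exact hcl.2 g hg x hx y hy hxy (by simp [exch_of_mem hgD hge]) (by simp [exch_of_mem hgD hge])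
  · refine hcl.2 g hg x hx y hy hxy ?_ ?_ <;> rw [exch_of_notMem hgD hge]
    exacts [ha, hab]

end exchange

end QuasitreePacking

/-! ### Chains of optimal refinements -/

namespace QuasitreePacking

variable {V E : Type*}

/-- The three phases through which a chain of refinements runs cyclically. -/
inductive Phase
  | expose
  | tree
  | anti

/-- A stage of the refinement process: a partition `part` of the vertex set, a set `res` of
hyperedges which may no longer be used inside the classes of the partition, and the set `adm` of all
acyclic quasigraphs for which the process took the same course up to this stage. -/
structure Stage (V E : Type*) where
  phase : Phase
  part : Setoid V
  res : Set E
  adm : Set (E → Finset V)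

/-- The hyperedge `f` has at most one vertex in each class of `P`. -/
def Separated (inc : E → Finset V) (P : Setoid V) (f : E) : Prop :=
  ∀ x ∈ inc f, ∀ y ∈ inc f, P x y → x = y

/-- Among the values that `step` takes on `A`, the partition `Q` is a coarsest one. -/
def Optimal (A : Set (E → Finset V)) (step : (E → Finset V) → Setoid V) (Q : Setoid V) : Prop :=
  (∃ π ∈ A, step π = Q) ∧ ∀ π ∈ A, Q ≤ step π → step π = Q

/-- At most one further hyperedge is reserved, and the admissible quasigraphs are restricted to those that
stay inside the classes of the partition on a set `C` of hyperedges. A hyperedge may be reserved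
only if all the admissible quasigraphs are connected on the classes. -/
structure ExposeStep (s t : Stage V E) : Prop where
  phase_left : s.phase = .expose
  phase_right : t.phase = .tree
  part_eq : t.part = s.part
  res_subset : s.res ⊆ t.res
  res_new : ∀ f ∈ t.res, ∀ g ∈ t.res, f ∉ s.res → g ∉ s.res → f = g
  conn : ∀ f ∈ t.res, f ∉ s.res → ∀ π ∈ s.adm, treeRefine s.res s.part π = s.part
  adm_eq : ∃ C : Set E, t.adm = {π ∈ s.adm | ∀ g ∈ C, ∀ a ∈ π g, ∀ b ∈ π g, s.part a b}

/-- The partition is refined into components. -/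
structure TreeStep (s t : Stage V E) : Prop where
  phase_left : s.phase = .tree
  phase_right : t.phase = .anti
  res_eq : t.res = s.res
  opt : Optimal s.adm (treeRefine s.res s.part) t.part
  adm_eq : t.adm = {π ∈ s.adm | treeRefine s.res s.part π = t.part}

/-- The partition is refined into anticomponents. -/
structure AntiStep (inc : E → Finset V) (s t : Stage V E) : Prop where
  phase_left : s.phase = .anti
  phase_right : t.phase = .expose
  res_eq : t.res = s.res
  opt : Optimal s.adm (antiRefine inc s.res s.part) t.part
  adm_eq : t.adm = {π ∈ s.adm | antiRefine inc s.res s.part π = t.part}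
  sep : ∀ f ∈ t.res, Separated inc t.part f

/-- One step of the refinement process. -/
def Next (inc : E → Finset V) (s t : Stage V E) : Prop :=
  ExposeStep s t ∨ TreeStep s t ∨ AntiStep inc s t

/-- The trivial partition, for which all acyclic quasigraphs are admissible. -/
def initStage (inc : E → Finset V) : Stage V E where
  phase := .expose
  part := ⊤
  res := ∅
  adm := {π | IsQuasi inc π ∧ Acyclic π}

/-- The first `N` steps of the sequence `s` are steps of the refinement process. -/
structure IsChain (inc : E → Finset V) (s : ℕ → Stage V E) (N : ℕ) : Prop where
  zero : s 0 = initStage inc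
  next : ∀ j < N, Next inc (s j) (s (j + 1))

section chain

variable {inc : E → Finset V} {s t : Stage V E}

theorem Next.part_le (h : Next inc s t) : t.part ≤ s.part := by
  rcases h with h | h | h
  · exact h.part_eq.le
  · obtain ⟨π, -, hπ⟩ := h.opt.1
    exact hπ ▸ treeRefine_le
  · obtain ⟨π, -, hπ⟩ := h.opt.1
    exact hπ ▸ antiRefine_le

theorem Next.res_subset (h : Next inc s t) : s.res ⊆ t.res := by
  rcases h with h | h | h
  exacts [h.res_subset, h.res_eq.ge, h.res_eq.ge]

theorem Next.adm_subset (h : Next inc s t) : t.adm ⊆ s.adm := by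
  rcases h with h | h | h
  · obtain ⟨C, hC⟩ := h.adm_eq
    rw [hC]; exact fun _ h => h.1
  all_goals rw [h.adm_eq]; exact fun _ h => h.1

theorem Separated.mono {P Q : Setoid V} {f : E} (h : Separated inc P f) (hQ : Q ≤ P) :
    Separated inc Q f := fun x hx y hy hxy => h x hx y hy (hQ hxy)

variable {s : ℕ → Stage V E} {N : ℕ} (h : IsChain inc s N)
include h

theorem IsChain.anti {i j : ℕ} (hij : i ≤ j) (hj : j ≤ N) :
    (s j).part ≤ (s i).part ∧ (s i).res ⊆ (s j).res ∧ (s j).adm ⊆ (s i).adm := by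
  induction j, hij using Nat.le_induction with
  | base => exact ⟨le_rfl, subset_rfl, subset_rfl⟩
  | succ j _ ih =>
    obtain ⟨h1, h2, h3⟩ := ih (by omega)
    have hn := h.next j (by omega)
    exact ⟨hn.part_le.trans h1, h2.trans hn.res_subset, hn.adm_subset.trans h3⟩

theorem IsChain.part_le {i j : ℕ} (hij : i ≤ j) (hj : j ≤ N) : (s j).part ≤ (s i).part :=
  (h.anti hij hj).1

theorem IsChain.res_subset {i j : ℕ} (hij : i ≤ j) (hj : j ≤ N) : (s i).res ⊆ (s j).res :=
  (h.anti hij hj).2.1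

theorem IsChain.adm_subset {i j : ℕ} (hij : i ≤ j) (hj : j ≤ N) : (s j).adm ⊆ (s i).adm :=
  (h.anti hij hj).2.2

theorem IsChain.isQuasi {j : ℕ} (hj : j ≤ N) {π : E → Finset V} (hπ : π ∈ (s j).adm) :
    IsQuasi inc π ∧ Acyclic π := by
  have := h.adm_subset (Nat.zero_le j) hj hπ
  rwa [h.zero] at this

theorem IsChain.separated_of_expose {j : ℕ} (hj : j ≤ N) (hp : (s j).phase = .expose) :
    ∀ f ∈ (s j).res, Separated inc (s j).part f := by
  rcases j with _ | j
  · rw [h.zero]; exact fun f hf => hf.elim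
  · rcases h.next j (by omega) with hn | hn | hn
    · rw [hn.phase_right] at hp; cases hp
    · rw [hn.phase_right] at hp; cases hp
    · exact hn.sep

theorem IsChain.separated_of_tree {i j : ℕ} (hij : i < j) (hj : j ≤ N) (hp : (s j).phase = .tree) :
    ∀ f ∈ (s i).res, Separated inc (s j).part f := by
  obtain ⟨j, rfl⟩ : ∃ k, j = k + 1 := ⟨j - 1, by omega⟩
  rcases h.next j (by omega) with hn | hn | hn
  · intro f hf
    rw [hn.part_eq]
    exact h.separated_of_expose (by omega) hn.phase_left f
      (h.res_subset (by omega : i ≤ j) (by omega) hf)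
  · rw [hn.phase_right] at hp; cases hp
  · rw [hn.phase_right] at hp; cases hp

/-- At each stage, at most one reserved hyperedge has two vertices in the same class. -/
theorem IsChain.eq_of_not_separated {j : ℕ} (hj : j ≤ N) {f g : E} (hf : f ∈ (s j).res)
    (hg : g ∈ (s j).res) (hf' : ¬ Separated inc (s j).part f)
    (hg' : ¬ Separated inc (s j).part g) : f = g := by
  induction j with
  | zero => rw [h.zero] at hf; exact hf.elim
  | succ j ih =>
    rcases h.next j (by omega) with hn | hn | hn
    · have hsep := h.separated_of_expose (by omega) hn.phase_left
      rw [hn.part_eq] at hf' hg'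
      exact hn.res_new f hf g hg (fun h => hf' (hsep f h)) (fun h => hg' (hsep g h))
    · have hle := (h.next j (by omega)).part_le
      rw [hn.res_eq] at hf hg
      exact ih (by omega) hf hg (fun h => hf' (h.mono hle)) (fun h => hg' (h.mono hle))
    · exact (hf' (hn.sep f hf)).elim

end chain

/-! ### The exchange argument -/

section exchange

variable {inc : E → Finset V} {s : ℕ → Stage V E} {N : ℕ}

/-- The common situation of the exchange argument. The quasigraph `π` is admissible at stage `N`,
where the hyperedge `e` is not used, and is not needed for the anticonnectedness of the classes. Its
vertices `u`, `w` are in the same class at stage `m`, and in this class they are connected through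
the classes of stage `N` and hyperedges other than `e` that `π` does not use for crossing these. -/
structure Configuration (inc : E → Finset V) (s : ℕ → Stage V E) (N m : ℕ) (π : E → Finset V)
    (C : Set E) (e : E) (u w : V) : Prop where
  chain : IsChain inc s N
  card_le : ∀ g, (inc g).card ≤ 3
  mem_adm : π ∈ (s N).adm
  unused : π e = ∅
  anti_eq : antiRefine inc (insert e (s N).res) (s N).part π = (s N).part
  noncrossing : ∀ g ∈ C, ∀ a ∈ π g, ∀ b ∈ π g, (s N).part a b
  lt : m < N
  phase_eq : (s m).phase = .tree
  notMem : e ∉ (s m).res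
  left_mem : u ∈ inc e
  right_mem : w ∈ inc e
  rel : (s m).part u w
  not_rel : ¬ (s (m + 1)).part u w
  joined : glue inc (s N).part (s m).part (C \ {e}) u w

namespace Configuration

variable {m : ℕ} {π : E → Finset V} {C : Set E} {e : E} {u w : V}

theorem ne (h : Configuration inc s N m π C e u w) : u ≠ w := by
  rintro rfl; exact h.not_rel (Setoid.refl' _ _)

variable [DecidableEq V] (h : Configuration inc s N m π C e u w) {D : Set E} {J : ℕ}
include h

theorem antiRefine_le_exch {j : ℕ} (hj : j < m) :
    antiRefine inc (s j).res (s j).part π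
      ≤ antiRefine inc (s j).res (s j).part (exch π e u w D) := by
  have hN := h.lt
  refine QuasitreePacking.antiRefine_le_exch h.card_le (h.chain.isQuasi le_rfl h.mem_adm).1
    h.anti_eq (h.chain.res_subset (by omega : j ≤ N) le_rfl)
    (h.chain.part_le (by omega : j ≤ N) le_rfl) (h.chain.part_le hj.le (by omega))
    h.noncrossing ?_ h.left_mem h.right_mem h.ne h.rel h.joined
  intro g _ x hx y hy hxy hrel hg
  exact hxy (h.chain.separated_of_tree hj (by omega) h.phase_eq g hg x hx y hy hrel)

/-- The exchanged quasigraph takes the same course as `π` up to stage `J`. -/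
theorem exch_mem_adm (hJ : J ≤ m)
    (hD : ∀ f ∈ D, ∀ a ∈ π f, ∀ b ∈ π f,
      (s J).part a b ∧ treeRefine (s J).res (s J).part (exch π e u w D) a b)
    (hac : Acyclic (exch π e u w D)) : exch π e u w D ∈ (s J).adm := by
  have hN := h.lt
  obtain ⟨hq, -⟩ := h.chain.isQuasi le_rfl h.mem_adm
  suffices ∀ j ≤ J, exch π e u w D ∈ (s j).adm from this J le_rfl
  intro j hj
  induction j with
  | zero =>
    rw [h.chain.zero]
    exact ⟨hq.exch h.left_mem h.right_mem h.ne, hac⟩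
  | succ j ih =>
    have ih := ih (by omega)
    have hmem : π ∈ (s (j + 1)).adm := h.chain.adm_subset (by omega) le_rfl h.mem_adm
    have huw : (s (j + 1)).part u w := h.chain.part_le (by omega) (by omega) h.rel
    have hDj : ∀ f ∈ D, ∀ a ∈ π f, ∀ b ∈ π f, (s (j + 1)).part a b := fun f hf a ha b hb =>
      h.chain.part_le hj (by omega) (hD f hf a ha b hb).1
    rcases h.chain.next j (by omega) with hn | hn | hn
    · obtain ⟨K, hK⟩ := hn.adm_eq
      rw [hK] at hmem ⊢
      rw [hn.part_eq] at huw
      exact ⟨ih, fun g hg => exch_pairs huw fun _ _ => hmem.2 g hg⟩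
    · rw [hn.adm_eq] at hmem ⊢
      refine ⟨ih, le_antisymm ?_ ?_⟩
      · exact (exch_treeRefine_le (hmem.2 ▸ huw)).trans hmem.2.le
      · refine hmem.2.ge.trans (treeRefine_le_exch h.unused fun f hf a ha b hb => ?_)
        exact treeRefine_mono (h.chain.res_subset (by omega) (by omega))
          (h.chain.part_le (by omega) (by omega)) (hD f hf a ha b hb).2
    · rw [hn.adm_eq] at hmem ⊢
      refine ⟨ih, le_antisymm ?_ ?_⟩
      · exact (exch_antiRefine_le h.card_le hq h.unused
          (by rw [hmem.2]; exact hDj)).trans hmem.2.le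
      · exact hmem.2.ge.trans (h.antiRefine_le_exch (by omega))

theorem joined_by_used : glue π ⊥ ⊤ Set.univ u w := by
  by_contra hnot
  have hN := h.lt
  have hac : Acyclic (exch π e u w ∅) :=
    (h.chain.isQuasi le_rfl h.mem_adm).2.exch h.unused (by rwa [Set.compl_empty])
  have hmem := h.exch_mem_adm le_rfl (D := ∅) (by simp) hac
  have hπ : π ∈ (s (m + 1)).adm := h.chain.adm_subset (by omega) le_rfl h.mem_adm
  rcases h.chain.next m h.lt with hn | hn | hn
  · have := hn.phase_left; rw [h.phase_eq] at this; cases this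
  · rw [hn.adm_eq] at hπ
    have hle := hn.opt.2 _ hmem (hπ.2.ge.trans (treeRefine_le_exch h.unused (by simp)))
    apply h.not_rel
    rw [← hle]
    exact treeRefine_of_mem h.notMem (by simp [exch_self]) (by simp [exch_self]) h.rel
  · have := hn.phase_left; rw [h.phase_eq] at this; cases this

/-- In a minimal set `S` of edges of `π` connecting `u` and `w`, the edge `f` can be replaced
by `uw`. -/
theorem treeRefine_exch {S : Set E} {f : E} (hS : glue π ⊥ ⊤ S u w)
    (hSf : ¬ glue π ⊥ ⊤ (S \ {f}) u w) {F : Set E} {P : Setoid V} (heF : e ∉ F) (huw : P u w)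
    (hF : ∀ g ∈ S, g ≠ f → g ∉ F) (hP : ∀ g ∈ S, g ≠ f → ∀ a ∈ π g, ∀ b ∈ π g, P a b) :
    ∀ a ∈ π f, ∀ b ∈ π f, treeRefine F P (exch π e u w {f}) a b := by
  have hle : glue π ⊥ ⊤ (S \ {f}) ≤ treeRefine F P (exch π e u w {f}) := by
    refine glue_le bot_le fun g hg a ha b hb _ => ?_
    have hge : g ≠ e := by rintro rfl; simp [h.unused] at ha
    refine treeRefine_of_mem (hF g hg.1 hg.2) ?_ ?_ (hP g hg.1 hg.2 a ha b hb) <;>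
      rwa [exch_of_notMem hg.2 hge]
  have huw' : treeRefine F P (exch π e u w {f}) u w :=
    treeRefine_of_mem heF (by simp [exch_self]) (by simp [exch_self]) huw
  have hins : glue π ⊥ ⊤ S ≤ joinSet (glue π ⊥ ⊤ (S \ {f})) (π f) :=
    (glue_mono le_rfl le_rfl (by simp)).trans
      (glue_insert_le fun x hx y hy _ => Or.inr ⟨hx, hy⟩)
  rcases hins hS with h1 | ⟨⟨a, ha, hua⟩, b, hb, hwb⟩
  · exact (hSf h1).elim
  · have hab : treeRefine F P (exch π e u w {f}) a b :=
      Setoid.trans' _ (Setoid.symm' _ (hle hua)) (Setoid.trans' _ huw' (hle hwb))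
    have hne : a ≠ b := by
      rintro rfl; exact hSf (Setoid.trans' _ hua (Setoid.symm' _ hwb))
    exact (h.chain.isQuasi le_rfl h.mem_adm).1.rel_of_pair ha hb hne hab

/-- The exchange argument: replacing `π` by a quasigraph that uses `e` as the edge `uw` would
improve one of the optimal partitions in the chain. -/
theorem false [Finite E] : False := by
  classical
  have hN := h.lt
  obtain ⟨hq, hac⟩ := h.chain.isQuasi le_rfl h.mem_adm
  -- `S` is the edge set of the path of `π` between `u` and `w`.
  obtain ⟨S, hS⟩ := (Set.toFinite {S : Set E | glue π ⊥ ⊤ S u w}).exists_minimal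
    ⟨Set.univ, h.joined_by_used⟩
  have hSf : ∀ f ∈ S, ¬ glue π ⊥ ⊤ (S \ {f}) u w := fun f hf hglue =>
    (hS.2 hglue Set.sdiff_subset hf).2 rfl
  have hD : ∀ f ∈ S, ¬ glue π ⊥ ⊤ ({f} : Set E)ᶜ u w := by
    intro f hf hglue
    have hins : glue π ⊥ ⊤ S ≤ joinSet (glue π ⊥ ⊤ (S \ {f})) (π f) :=
      (glue_mono le_rfl le_rfl (by simp)).trans
        (glue_insert_le fun x hx y hy _ => Or.inr ⟨hx, hy⟩)
    have hle : glue π ⊥ ⊤ (S \ {f}) ≤ glue π ⊥ ⊤ ({f} : Set E)ᶜ :=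
      glue_mono le_rfl le_rfl fun g hg => hg.2
    rcases hins hS.1 with h1 | ⟨⟨a, ha, hua⟩, b, hb, hwb⟩
    · exact hSf f hf h1
    · refine hac f a ha b hb ?_ ?_
      · rintro rfl; exact hSf f hf (Setoid.trans' _ hua (Setoid.symm' _ hwb))
      · exact Setoid.trans' _ (Setoid.symm' _ (hle hua)) (Setoid.trans' _ hglue (hle hwb))
  let good : ℕ → Prop := fun j => (∀ g ∈ S, g ∉ (s j).res) ∧
    ∀ g ∈ S, ∀ a ∈ π g, ∀ b ∈ π g, (s j).part a b
  have good0 : good 0 := by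
    refine ⟨fun _ _ => ?_, fun _ _ _ _ _ _ => ?_⟩ <;> rw [h.chain.zero]
    exacts [fun h => h, trivial]
  have goodm : ¬ good m := by
    rintro ⟨h1, h2⟩
    have hπ : π ∈ (s (m + 1)).adm := h.chain.adm_subset (by omega) le_rfl h.mem_adm
    rcases h.chain.next m h.lt with hn | hn | hn
    · have := hn.phase_left; rw [h.phase_eq] at this; cases this
    · rw [hn.adm_eq] at hπ
      apply h.not_rel
      rw [← hπ.2]
      refine (glue_le bot_le fun g hg a ha b hb _ => ?_ : glue π ⊥ ⊤ S ≤ _) hS.1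
      exact treeRefine_of_mem (h1 g hg) ha hb (h2 g hg a ha b hb)
    · have := hn.phase_left; rw [h.phase_eq] at this; cases this
  obtain ⟨k, hkm, hk, hk'⟩ : ∃ k < m, good k ∧ ¬ good (k + 1) := by
    by_contra! hcon
    have : ∀ j ≤ m, good j := by
      intro j hj
      induction j with
      | zero => exact good0
      | succ j ih => exact hcon j (by omega) (ih (by omega))
    exact goodm (this m le_rfl)
  have hπ1 : π ∈ (s (k + 1)).adm := h.chain.adm_subset (by omega) le_rfl h.mem_adm
  have huw : ∀ j ≤ m, (s j).part u w := fun j hj => h.chain.part_le hj (by omega) h.rel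
  have heF : ∀ j ≤ m, e ∉ (s j).res := fun j hj he =>
    h.notMem (h.chain.res_subset hj (by omega) he)
  rcases h.chain.next k (by omega) with hn | hn | hn
  · -- An edge `f` of the path becomes reserved; its removal improves the next tree step.
    have hres : ∃ f ∈ S, f ∈ (s (k + 1)).res := by
      by_contra! hcon
      refine hk' ⟨hcon, ?_⟩
      rw [hn.part_eq]; exact hk.2
    obtain ⟨f, hfS, hf⟩ := hres
    have hconn := hn.conn f hf (hk.1 f hfS)
    have hrel : ∀ g ∈ S, ∀ a ∈ π g, ∀ b ∈ π g, (s (k + 1)).part a b := by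
      rw [hn.part_eq]; exact hk.2
    have hswap := h.treeRefine_exch hS.1 (hSf f hfS) (heF (k + 1) (by omega))
      (huw (k + 1) (by omega))
      (fun g hg hgf hgr => hgf (hn.res_new g hgr f hf (hk.1 g hg) (hk.1 f hfS)))
      (fun g hg _ => hrel g hg)
    have hmem := h.exch_mem_adm (D := {f}) (J := k + 1) (by omega)
      (by rintro _ rfl a ha b hb; exact ⟨hrel _ hfS a ha b hb, hswap a ha b hb⟩)
      (hac.exch h.unused (hD f hfS))
    have hπ0 : π ∈ (s k).adm := h.chain.adm_subset (by omega) le_rfl h.mem_adm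
    have hge : (s (k + 1)).part ≤
        treeRefine (s (k + 1)).res (s (k + 1)).part (exch π e u w {f}) := by
      rw [hn.part_eq]
      conv_lhs => rw [← hconn π hπ0]
      refine treeRefine_le_of fun g hg a ha b hb hab => ?_
      by_cases hgf : g = f
      · subst hgf
        rw [← hn.part_eq]; exact hswap a ha b hb
      · have hge : g ≠ e := by rintro rfl; simp [h.unused] at ha
        refine treeRefine_of_mem
          (fun hgr => hgf (hn.res_new g hgr f hf hg (hk.1 f hfS))) ?_ ?_ hab <;>
          rwa [exch_of_notMem (show g ∉ ({f} : Set E) from hgf) hge]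
    rcases h.chain.next (k + 1) (by omega) with hn' | hn' | hn'
    · have := hn'.phase_left; rw [hn.phase_right] at this; cases this
    · have hπ2 : π ∈ (s (k + 1 + 1)).adm := h.chain.adm_subset (by omega) le_rfl h.mem_adm
      have hle := (h.chain.next (k + 1) (by omega)).part_le
      have heq := hn'.opt.2 _ hmem (hle.trans hge)
      rw [hn'.adm_eq] at hπ2
      -- Hence `π` is connected on the classes without `f`, contrary to its acyclicity.
      have hP : (s (k + 1)).part ≤ treeRefine (s (k + 1)).res (s (k + 1)).part π := by
        rw [hπ2.2, ← heq]; exact hge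
      have hle' : treeRefine (s (k + 1)).res (s (k + 1)).part π ≤ glue π ⊥ ⊤ ({f} : Set E)ᶜ :=
        glue_mono le_rfl le_top fun g hg hgf => hg (by rw [hgf]; exact hf)
      have hne : (π f).Nonempty := by
        by_contra hemp
        rw [Finset.not_nonempty_iff_eq_empty] at hemp
        refine hSf f hfS ((glue_le bot_le fun g hg a ha b hb _ => ?_ : glue π ⊥ ⊤ S ≤ _) hS.1)
        refine glue_of_mem (D := S \ {f}) ⟨hg, ?_⟩ ha hb trivial
        rintro rfl; simp [hemp] at ha
      obtain ⟨a, ha⟩ := hne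
      obtain ⟨b, hb, hab⟩ := hq.pair ha
      exact hac f a ha b hb hab (hle' (hP (hrel f hfS a ha b hb)))
    · have := hn'.phase_left; rw [hn.phase_right] at this; cases this
  · refine hk' ⟨by rw [hn.res_eq]; exact hk.1, fun g hg a ha b hb => ?_⟩
    rw [hn.adm_eq] at hπ1
    rw [← hπ1.2]
    exact treeRefine_of_mem (hk.1 g hg) ha hb (hk.2 g hg a ha b hb)
  · -- The anticomponents separate the ends of an edge `f` of the path.
    obtain ⟨f, hfS, a, ha, b, hb, hab⟩ :
        ∃ f ∈ S, ∃ a ∈ π f, ∃ b ∈ π f, ¬ (s (k + 1)).part a b := by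
      by_contra! hcon
      exact hk' ⟨by rw [hn.res_eq]; exact hk.1, hcon⟩
    have hswap := h.treeRefine_exch hS.1 (hSf f hfS) (heF k (by omega)) (huw k (by omega))
      (fun g hg _ => hk.1 g hg) (fun g hg _ => hk.2 g hg)
    have hmem := h.exch_mem_adm (D := {f}) (J := k) (by omega)
      (by rintro _ rfl a ha b hb; exact ⟨hk.2 _ hfS a ha b hb, hswap a ha b hb⟩)
      (hac.exch h.unused (hD f hfS))
    rw [hn.adm_eq] at hπ1
    have heq := hn.opt.2 _ hmem (hπ1.2.ge.trans (h.antiRefine_le_exch hkm))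
    have hfe : f ≠ e := by rintro rfl; simp [h.unused] at ha
    have hemp : exch π e u w {f} f = ∅ := exch_of_mem rfl hfe
    apply hab
    rw [← heq]
    exact antiClosed_antiRefine.2 f (hk.1 f hfS) a (hq.subset f ha) b (hq.subset f hb)
      (hk.2 f hfS a ha b hb) (by simp [hemp]) (by simp [hemp])

end Configuration

end exchange

end QuasitreePacking

/-! ### Cycles in the complement -/

namespace QuasitreePacking

variable {V E : Type*}

/-- A set of at most three vertices has two vertices in at most one class of a partition. -/
theorem exists_trace {S : Finset V} (hS : S.card ≤ 3) (P : Setoid V) :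
    ∃ T : Set V, (∀ x ∈ T, x ∈ S) ∧ (∀ x ∈ T, ∀ y ∈ T, P x y) ∧
      ∀ x ∈ S, ∀ y ∈ S, P x y → x = y ∨ (x ∈ T ∧ y ∈ T) := by
  by_cases h : ∃ x ∈ S, ∃ y ∈ S, x ≠ y ∧ P x y
  · obtain ⟨x, hx, y, hy, hne, hxy⟩ := h
    refine ⟨{z | z ∈ S ∧ P z x}, fun z hz => hz.1,
      fun z hz z' hz' => P.trans' hz.2 (P.symm' hz'.2), fun z hz z' hz' hzz' => ?_⟩
    by_cases hne' : z = z'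
    · exact Or.inl hne'
    · have key : P z x := by
        rcases pairs_meet hS hz hz' hx hy hne' hne with rfl | rfl | rfl | rfl
        · exact P.refl' _
        · exact P.symm' hxy
        · exact hzz'
        · exact P.trans' hzz' (P.symm' hxy)
      exact Or.inr ⟨⟨hz, key⟩, hz', P.trans' (P.symm' hzz') key⟩
  · push Not at h
    refine ⟨∅, by simp, by simp, fun x hx y hy hxy => ?_⟩
    by_contra hcon
    rw [not_or] at hcon
    exact h x hx y hy hcon.1 hxy

/-- If a set of at most three vertices is not contained in a class of `L`, then it contains at most
one pair of distinct vertices in the same class. -/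
theorem pair_unique {S : Finset V} (hS : S.card ≤ 3) {L : Setoid V} {u w : V} (hu : u ∈ S)
    (hw : w ∈ S) (huw : ¬ L u w) {x y a b : V} (hx : x ∈ S) (hy : y ∈ S) (hxy : L x y)
    (hne : x ≠ y) (ha : a ∈ S) (hb : b ∈ S) (hab : L a b) :
    a = b ∨ (a = x ∧ b = y) ∨ (a = y ∧ b = x) := by
  classical
  obtain ⟨T, hTS, hTL, hT⟩ := exists_trace hS L
  by_contra! hcon
  obtain ⟨hab', h1, h2⟩ := hcon
  have hx' := (hT x hx y hy hxy).resolve_left hne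
  have ha' := (hT a ha b hb hab).resolve_left hab'
  have hST : ∀ z ∈ S, z ∈ T := by
    intro z hz
    by_contra hzT
    have hsub : ∀ p ∈ T, p ∈ S.erase z := fun p hp =>
      Finset.mem_erase.2 ⟨by rintro rfl; exact hzT hp, hTS p hp⟩
    have hcard : (S.erase z).card ≤ 2 := by
      rw [Finset.card_erase_of_mem hz]; omega
    have heq : ({x, y} : Finset V) = S.erase z := by
      refine Finset.eq_of_subset_of_card_le ?_ (by rw [Finset.card_pair hne]; exact hcard)
      intro p hp
      simp only [Finset.mem_insert, Finset.mem_singleton] at hp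
      rcases hp with rfl | rfl
      exacts [hsub _ hx'.1, hsub _ hx'.2]
    have hax := hsub a ha'.1
    have hbx := hsub b ha'.2
    rw [← heq] at hax hbx
    simp only [Finset.mem_insert, Finset.mem_singleton] at hax hbx
    rcases hax with rfl | rfl <;> rcases hbx with rfl | rfl
    exacts [hab' rfl, h1 rfl rfl, h2 rfl rfl, hab' rfl]
  exact huw (hTL u (hST u hu) w (hST w hw))

/-- If a cycle of hyperedges in `C` through `e` stays within the classes of `P` but is broken by the
refinement `P'`, then some hyperedge other than `e` of such a cycle crosses `P'`. -/
theorem exists_crossing [Finite E] {inc : E → Finset V} (h3 : ∀ g, (inc g).card ≤ 3)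
    {L P P' : Setoid V} (hP : P' ≤ P) {C : Set E} {e : E} {u w : V} (he : e ∈ C) (hu : u ∈ inc e)
    (hw : w ∈ inc e) (huw : P u w) (hglue : glue inc L P (C \ {e}) u w)
    (hnot : ¬ glue inc L P' (C \ {e}) u w) :
    ∃ f ∈ C, f ≠ e ∧ ∃ a ∈ inc f, ∃ b ∈ inc f, P a b ∧ ¬ P' a b ∧
      glue inc L P (C \ {f}) a b := by
  classical
  by_contra! hcon
  -- Hyperedges in `D` are used with their traces on the classes of `P`, all others with the smaller
  -- traces on the classes of `P'`. The set `D` is enlarged one hyperedge at a time.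
  suffices key : ∀ D : Set E, D.Finite →
      ¬ glue inc (glue inc L P' (C \ {e})) P ((C \ {e}) ∩ D) u w from
    key Set.univ Set.finite_univ
      (glue_mono le_glue le_rfl (by rw [Set.inter_univ]) hglue)
  intro D hD
  induction D, hD using Set.Finite.induction_on with
  | empty =>
    refine fun h => hnot ((glue_le le_rfl fun g hg => ?_ : glue inc _ P _ ≤ _) h)
    exact absurd hg.2 (by simp)
  | @insert f D hfD _ ih =>
    intro h
    by_cases hf : f ∈ C \ {e}
    · have hfC : f ∈ C := hf.1
      have hfe : f ≠ e := hf.2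
      set s0 := glue inc (glue inc L P' ((C \ {e}) \ {f})) P ((C \ {e}) ∩ D) with hs0
      obtain ⟨T, hTf, hTP, hT⟩ := exists_trace (h3 f) P
      have hle : glue inc (glue inc L P' (C \ {e})) P ((C \ {e}) ∩ insert f D)
          ≤ joinSet s0 T := by
        rw [Set.inter_insert_of_mem hf]
        refine glue_le (glue_le ?_ ?_) ?_
        · exact le_glue.trans (le_glue.trans (le_joinSet _ _))
        · intro g hg x hx y hy hxy
          by_cases hgf : g = f
          · subst hgf
            rcases hT x hx y hy (hP hxy) with rfl | ⟨h1, h2⟩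
            · exact Setoid.refl' _ _
            · exact joinSet_of_mem h1 h2
          · exact le_joinSet _ _ (le_glue (glue_of_mem
              (show g ∈ (C \ {e}) \ {f} from ⟨hg, hgf⟩) hx hy hxy))
        · rintro g (rfl | hg) x hx y hy hxy
          · rcases hT x hx y hy hxy with rfl | ⟨h1, h2⟩
            · exact Setoid.refl' _ _
            · exact joinSet_of_mem h1 h2
          · exact le_joinSet _ _ (glue_of_mem hg hx hy hxy)
      have hs : s0 ≤ glue inc (glue inc L P' (C \ {e})) P ((C \ {e}) ∩ D) :=
        glue_mono (glue_mono le_rfl le_rfl Set.sdiff_subset) le_rfl subset_rfl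
      have hs' : s0 ≤ glue inc L P (C \ {f}) := by
        refine glue_le (glue_mono le_rfl hP fun g hg => ⟨hg.1.1, hg.2⟩) ?_
        intro g hg x hx y hy hxy
        refine glue_of_mem (D := C \ {f}) ⟨hg.1.1, ?_⟩ hx hy hxy
        rintro rfl; exact hfD hg.2
      rcases hle h with h1 | ⟨⟨a, ha, hua⟩, b, hb, hwb⟩
      · exact ih (hs h1)
      · refine hcon f hfC hfe a (hTf a ha) b (hTf b hb) (hTP a ha b hb) ?_ ?_
        · intro hab
          refine ih (Setoid.trans' _ (hs hua) (Setoid.trans' _ ?_ (Setoid.symm' _ (hs hwb))))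
          exact le_glue (glue_of_mem hf (hTf a ha) (hTf b hb) hab)
        · refine Setoid.trans' _ (Setoid.symm' _ (hs' hua)) (Setoid.trans' _ ?_ (hs' hwb))
          exact glue_of_mem (D := C \ {f}) ⟨he, fun h => hfe h.symm⟩ hu hw huw
    · rw [Set.inter_insert_of_notMem hf] at h
      exact ih h

/-! ### Existence of a skeletal partition -/

section skeletal

variable {inc : E → Finset V}

/-- The stage `t` occurs at the end of a chain. -/
def Reachable (inc : E → Finset V) (t : Stage V E) : Prop :=
  ∃ (s : ℕ → Stage V E) (N : ℕ), IsChain inc s N ∧ s N = t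

theorem Reachable.next {t t' : Stage V E} (h : Reachable inc t) (ht : Next inc t t') :
    Reachable inc t' := by
  obtain ⟨s, N, hs, rfl⟩ := h
  refine ⟨fun j => if j ≤ N then s j else t', N + 1, ⟨by simpa using hs.zero, fun j hj => ?_⟩,
    by simp⟩
  by_cases hjN : j < N
  · simpa [hjN.le, Nat.succ_le_of_lt hjN] using hs.next j hjN
  · obtain rfl : j = N := by omega
    simpa using ht

theorem exists_optimal [Finite V] {A : Set (E → Finset V)} (hA : A.Nonempty)
    (step : (E → Finset V) → Setoid V) : ∃ Q, Optimal A step Q := by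
  have := finite_setoid (V := V)
  obtain ⟨Q, hQ, hmax⟩ := (Set.toFinite (step '' A)).exists_maximal (hA.image step)
  obtain ⟨π, hπ, rfl⟩ := hQ
  exact ⟨step π, ⟨π, hπ, rfl⟩, fun π' hπ' hle =>
    le_antisymm (hmax ⟨π', hπ', rfl⟩ hle) hle⟩

/-- A whole round of the refinement process, apart from the condition that the reserved hyperedges
have to be separated in the end. -/
theorem exists_round [Finite V] {t : Stage V E} (ht : Reachable inc t) (hp : t.phase = .expose)
    (F C : Set E) (hF : t.res ⊆ F) (hnew : ∀ f ∈ F, ∀ g ∈ F, f ∉ t.res → g ∉ t.res → f = g)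
    (hconn : ∀ f ∈ F, f ∉ t.res → ∀ π ∈ t.adm, treeRefine t.res t.part π = t.part)
    (hne : ∃ π ∈ t.adm, ∀ g ∈ C, ∀ a ∈ π g, ∀ b ∈ π g, t.part a b) :
    ∃ Q R A, Q ≤ t.part ∧ R ≤ Q ∧ A.Nonempty ∧
      (∀ π ∈ A, π ∈ t.adm ∧ (∀ g ∈ C, ∀ a ∈ π g, ∀ b ∈ π g, t.part a b) ∧
        treeRefine F t.part π = Q ∧ antiRefine inc F Q π = R) ∧
      ((∀ f ∈ F, Separated inc R f) → Reachable inc ⟨.expose, R, F, A⟩) := by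
  obtain ⟨π₀, hπ₀, hC⟩ := hne
  set A₁ : Set (E → Finset V) := {π ∈ t.adm | ∀ g ∈ C, ∀ a ∈ π g, ∀ b ∈ π g, t.part a b} with hA₁
  obtain ⟨Q, hQ⟩ := exists_optimal (A := A₁) ⟨π₀, hπ₀, hC⟩ (treeRefine F t.part)
  set A₂ : Set (E → Finset V) := {π ∈ A₁ | treeRefine F t.part π = Q} with hA₂
  obtain ⟨π₁, hπ₁, hQ₁⟩ := hQ.1
  obtain ⟨R, hR⟩ := exists_optimal (A := A₂) ⟨π₁, hπ₁, hQ₁⟩ (antiRefine inc F Q)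
  obtain ⟨π₂, hπ₂, hR₂⟩ := hR.1
  refine ⟨Q, R, {π ∈ A₂ | antiRefine inc F Q π = R}, ?_, ?_, ⟨π₂, hπ₂, hR₂⟩, ?_, fun hsep => ?_⟩
  · rw [← hQ₁]; exact treeRefine_le
  · rw [← hR₂]; exact antiRefine_le
  · exact fun π hπ => ⟨hπ.1.1.1, hπ.1.1.2, hπ.1.2, hπ.2⟩
  · have h1 : Next inc t ⟨.tree, t.part, F, A₁⟩ := Or.inl ⟨hp, rfl, rfl, hF, hnew, hconn, C, rfl⟩
    have h2 : Next inc ⟨.tree, t.part, F, A₁⟩ ⟨.anti, Q, F, A₂⟩ :=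
      Or.inr (Or.inl ⟨rfl, rfl, rfl, hQ, rfl⟩)
    exact ((ht.next h1).next h2).next (Or.inr (Or.inr ⟨rfl, rfl, rfl, hR, rfl, hsep⟩))

/-- A reachable stage at which no further refinement is possible. -/
theorem exists_final [Finite V] (inc : E → Finset V) : ∃ t : Stage V E, Reachable inc t ∧
    t.phase = .expose ∧ t.adm.Nonempty ∧
    (∀ π ∈ t.adm, treeRefine t.res t.part π = t.part ∧
      antiRefine inc t.res t.part π = t.part) ∧
    ∀ t', Reachable inc t' → t'.phase = .expose → t'.adm.Nonempty → t'.part ≤ t.part →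
      t'.part = t.part := by
  have := finite_setoid (V := V)
  have hinit : ({π | IsQuasi inc π ∧ Acyclic π} : Set (E → Finset V)).Nonempty :=
    ⟨fun _ => ∅, ⟨fun _ => by simp, fun _ => Or.inl rfl⟩, fun g a ha => by simp at ha⟩
  obtain ⟨Q, ⟨t, ht, hp, hne, rfl⟩, hmin⟩ := (Set.toFinite {Q : Setoid V | ∃ t : Stage V E,
    Reachable inc t ∧ t.phase = .expose ∧ t.adm.Nonempty ∧ t.part = Q}).exists_minimal
    ⟨_, initStage inc, ⟨fun _ => initStage inc, 0, ⟨rfl, by simp⟩, rfl⟩, rfl, hinit, rfl⟩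
  have hmin' : ∀ t', Reachable inc t' → t'.phase = .expose → t'.adm.Nonempty →
      t'.part ≤ t.part → t'.part = t.part := fun t' h1 h2 h3 h4 =>
    le_antisymm h4 (hmin ⟨t', h1, h2, h3, rfl⟩ h4)
  obtain ⟨π₀, hπ₀⟩ := hne
  obtain ⟨P, R, A, hP, hR, hA, hmem, hreach⟩ := exists_round ht hp t.res ∅ subset_rfl
    (fun f hf g _ h => (h hf).elim) (fun f hf h => (h hf).elim) ⟨π₀, hπ₀, by simp⟩
  have hsep : ∀ f ∈ t.res, Separated inc t.part f := by
    obtain ⟨s, N, hs, rfl⟩ := ht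
    exact hs.separated_of_expose le_rfl hp
  have hreach := hreach fun f hf => (hsep f hf).mono (hR.trans hP)
  obtain rfl : R = t.part := hmin' _ hreach rfl hA (hR.trans hP)
  obtain rfl : P = t.part := le_antisymm hP hR
  refine ⟨_, hreach, rfl, hA, fun π hπ => ⟨(hmem π hπ).2.2.1, (hmem π hπ).2.2.2⟩, ?_⟩
  exact hmin'

/-- There are an acyclic quasigraph `π` and a partition `L` such that `π` is connected and
anticonnected on each class of `L`, and the hyperedges `g` for which `π g` does not cross `L` form
an acyclic hypergraph on the classes of `L`. -/
theorem exists_skeletal [Finite V] [Finite E] (inc : E → Finset V) (h3 : ∀ g, (inc g).card ≤ 3) :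
    ∃ (π : E → Finset V) (F : Set E) (L : Setoid V), IsQuasi inc π ∧ Acyclic π ∧
      treeRefine F L π = L ∧ antiRefine inc F L π = L ∧
      ∀ C : Set E, (∀ g ∈ C, ∀ a ∈ π g, ∀ b ∈ π g, L a b) → ∀ e ∈ C, ∀ u ∈ inc e, ∀ w ∈ inc e,
        ¬ L u w → ¬ glue inc L ⊤ (C \ {e}) u w := by
  classical
  obtain ⟨t, ⟨s, N, hs, rfl⟩, hp, ⟨π₀, hπ₀⟩, hsolid, hmin⟩ := exists_final inc
  obtain ⟨hq, hac⟩ := hs.isQuasi le_rfl hπ₀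
  refine ⟨π₀, (s N).res, (s N).part, hq, hac, (hsolid π₀ hπ₀).1, (hsolid π₀ hπ₀).2, ?_⟩
  intro C hC e₀ he₀ u₀ hu₀ w₀ hw₀ hL₀ hglue₀
  set L := (s N).part with hL
  let G : ℕ → Prop := fun j => ∃ e ∈ C, ∃ u ∈ inc e, ∃ w ∈ inc e, ¬ L u w ∧ (s j).part u w ∧
    glue inc L (s j).part (C \ {e}) u w
  have hG0 : G 0 := ⟨e₀, he₀, u₀, hu₀, w₀, hw₀, hL₀, by rw [hs.zero]; trivial, by
    rw [hs.zero]; exact hglue₀⟩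
  have hGN : ¬ G N := by
    rintro ⟨e, -, u, -, w, -, h1, h2, -⟩; exact h1 h2
  obtain ⟨m, hm, hGm, hGm'⟩ : ∃ m < N, G m ∧ ¬ G (m + 1) := by
    by_contra! hcon
    have : ∀ j ≤ N, G j := by
      intro j hj
      induction j with
      | zero => exact hG0
      | succ j ih => exact hcon j (by omega) (ih (by omega))
    exact hGN (this N le_rfl)
  have hLm : L ≤ (s (m + 1)).part := hs.part_le (by omega) le_rfl
  have hmm : (s (m + 1)).part ≤ (s m).part := hs.part_le (by omega) (by omega)
  have hnew : ∀ e ∈ C, ∀ u ∈ inc e, ∀ w ∈ inc e, ¬ L u w → (s m).part u w →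
      glue inc L (s m).part (C \ {e}) u w → ∃ f ∈ C, f ≠ e ∧ ∃ a ∈ inc f, ∃ b ∈ inc f,
        (s m).part a b ∧ ¬ (s (m + 1)).part a b ∧ glue inc L (s m).part (C \ {f}) a b := by
    intro e he u hu w hw h1 h2 h4
    refine exists_crossing h3 hmm he hu hw h2 h4 fun h5 => hGm' ?_
    exact ⟨e, he, u, hu, w, hw, h1, glue_le hLm (fun _ _ _ _ _ _ h => h) h5, h5⟩
  -- Two hyperedges of the cycle cross the partition `m + 1`, and one of them is not reserved.
  obtain ⟨e, he, heF, u, hu, w, hw, huw, hnuw, hglue⟩ : ∃ e ∈ C, e ∉ (s m).res ∧ ∃ u ∈ inc e,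
      ∃ w ∈ inc e, (s m).part u w ∧ ¬ (s (m + 1)).part u w ∧
        glue inc L (s m).part (C \ {e}) u w := by
    obtain ⟨e, he, u, hu, w, hw, h1, h2, h4⟩ := hGm
    obtain ⟨e₁, he₁, -, u₁, hu₁, w₁, hw₁, k₁, k₁', k₁''⟩ := hnew e he u hu w hw h1 h2 h4
    obtain ⟨e₂, he₂, hne, u₂, hu₂, w₂, hw₂, k₂, k₂', k₂''⟩ :=
      hnew e₁ he₁ u₁ hu₁ w₁ hw₁ (fun h => k₁' (hLm h)) k₁ k₁''
    by_cases h₁ : e₁ ∈ (s m).res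
    · refine ⟨e₂, he₂, fun h₂ => hne ?_, u₂, hu₂, w₂, hw₂, k₂, k₂', k₂''⟩
      refine hs.eq_of_not_separated hm.le h₂ h₁ (fun h => ?_) (fun h => ?_)
      · exact k₂' (h _ hu₂ _ hw₂ k₂ ▸ Setoid.refl' _ _)
      · exact k₁' (h _ hu₁ _ hw₁ k₁ ▸ Setoid.refl' _ _)
    · exact ⟨e₁, he₁, h₁, u₁, hu₁, w₁, hw₁, k₁, k₁', k₁''⟩
  have hne : u ≠ w := by rintro rfl; exact hnuw (Setoid.refl' _ _)
  have hnL : ¬ L u w := fun h => hnuw (hLm h)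
  obtain ⟨Q, R, A, hQ, hR, ⟨π, hπ⟩, hmem, hreach⟩ :=
    exists_round ⟨s, N, hs, rfl⟩ hp (insert e (s N).res) C (Set.subset_insert _ _)
      (by
        rintro f (rfl | hf) g (rfl | hg) hf' hg'
        exacts [rfl, (hg' hg).elim, (hf' hf).elim, (hf' hf).elim])
      (fun f hf hf' π hπ => (hsolid π hπ).1) ⟨π₀, hπ₀, hC⟩
  obtain ⟨hπadm, hπC, hπQ, hπR⟩ := hmem π hπ
  obtain ⟨hq', hac'⟩ := hs.isQuasi le_rfl hπadm
  obtain ⟨hconn, hanti⟩ := hsolid π hπadm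
  by_cases hRL : R = L
  · obtain rfl : Q = L := le_antisymm hQ (hRL ▸ hR)
    refine Configuration.false (inc := inc) (s := s) (N := N) (m := m) (π := π) (C := C) (e := e)
      (u := u) (w := w) ⟨hs, h3, hπadm, ?_, hπR.trans hRL, hπC, hm, ?_, heF, hu, hw, huw, hnuw,
      hglue⟩
    · -- Otherwise the ends of `π e` are connected by the other edges of `π`.
      by_contra hemp
      obtain ⟨a, ha⟩ := Finset.nonempty_iff_ne_empty.2 hemp
      obtain ⟨b, hb, hab⟩ := hq'.pair ha
      refine hac' e a ha b hb hab ?_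
      have h1 : glue π ⊥ L (insert e (s N).res)ᶜ a b := by
        change treeRefine (insert e (s N).res) L π a b
        rw [hπQ]; exact hπC e he a ha b hb
      refine glue_mono le_rfl le_top ?_ h1
      exact Set.compl_subset_compl.2 (Set.singleton_subset_iff.2 (Set.mem_insert _ _))
    · rcases hs.next m hm with hn | hn | hn
      · exact (hnuw (by rw [hn.part_eq]; exact huw)).elim
      · exact hn.phase_left
      · exfalso
        have hadm : π₀ ∈ (s (m + 1)).adm := hs.adm_subset (by omega) le_rfl hπ₀
        rw [hn.adm_eq] at hadm
        apply hnuw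
        rw [← hadm.2]
        refine antiClosed_antiRefine.2 e heF u hu w hw huw ?_ ?_
        · exact hq.rep_near (h3 e) hu hw hne huw
            fun a ha b hb => hmm (hLm (hC e he a ha b hb))
        · rw [hadm.2]; exact fun a ha b hb => hLm (hC e he a ha b hb)
  · -- The partition has been refined, and then `e` is separated.
    refine hRL (hmin _ (hreach ?_) rfl ⟨π, hπ⟩ (hR.trans hQ))
    intro f hf
    rcases hf with rfl | hf
    · intro x hx y hy hxy
      by_contra hne'
      have hRel : ∀ a ∈ inc f, ∀ b ∈ inc f, L a b → R a b := by
        intro a ha b hb hab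
        rcases pair_unique (h3 f) hu hw hnL hx hy (hQ (hR hxy)) hne' ha hb hab with
          rfl | ⟨rfl, rfl⟩ | ⟨rfl, rfl⟩
        exacts [Setoid.refl' _ _, hxy, Setoid.symm' _ hxy]
      have hLQ : L ≤ Q := by
        conv_lhs => rw [← hconn]
        refine treeRefine_le_of fun g hg a ha b hb hab => ?_
        by_cases hgf : g = f
        · subst hgf
          exact hR (hRel a (hq'.subset g ha) b (hq'.subset g hb) hab)
        · rw [← hπQ]
          refine treeRefine_of_mem ?_ ha hb hab
          rintro (h | h)
          exacts [hgf h, hg h]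
      obtain rfl : Q = L := le_antisymm hQ hLQ
      refine hRL (le_antisymm hR ?_)
      conv_lhs => rw [← hanti]
      refine AntiClosed.antiRefine_le ⟨hR, fun g hg a ha b hb hab h1 h2 => ?_⟩
      by_cases hgf : g = f
      · subst hgf
        exact hRel a ha b hb hab
      · have hcl := antiClosed_antiRefine (inc := inc) (F := insert f (s N).res) (P := L) (π := π)
        rw [hπR] at hcl
        refine hcl.2 g ?_ a ha b hb hab h1 h2
        rintro (h | h)
        exacts [hgf h, hg h]
    · exact (hs.separated_of_expose le_rfl hp f hf).mono (hR.trans hQ)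

end skeletal

end QuasitreePacking

/-! ### Counting hyperedges -/

namespace QuasitreePacking

variable {V E : Type*}

open scoped Classical in
/-- The set of the classes of `L` that meet `T`. -/
noncomputable def classes (L : Setoid V) (T : Finset V) : Finset (Quotient L) :=
  T.image (Quotient.mk L)

theorem mem_classes {L : Setoid V} {T : Finset V} {q : Quotient L} :
    q ∈ classes L T ↔ ∃ x ∈ T, Quotient.mk L x = q := by
  simp [classes]

theorem card_classes_le {L : Setoid V} {T : Finset V} : (classes L T).card ≤ T.card := by
  classical exact Finset.card_image_le

theorem card_classes_mono {L s : Setoid V} {T : Finset V}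
    (h : ∀ x ∈ T, ∀ y ∈ T, s x y → L x y) : (classes L T).card ≤ (classes s T).card := by
  rcases T.eq_empty_or_nonempty with rfl | ⟨t, -⟩
  · simp [classes]
  have : Nonempty V := ⟨t⟩
  choose! f hfT hf using fun q (hq : q ∈ classes L T) => mem_classes.1 hq
  refine Finset.card_le_card_of_injOn (fun q => Quotient.mk s (f q))
    (fun q hq => mem_classes.2 ⟨f q, hfT q hq, rfl⟩) fun p hp q hq hpq => ?_
  rw [← hf p hp, ← hf q hq]
  exact Quotient.sound (h _ (hfT p hp) _ (hfT q hq) (Quotient.exact hpq))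

theorem card_quotient_le [Finite V] {s t : Setoid V} (h : s ≤ t) :
    Nat.card (Quotient t) ≤ Nat.card (Quotient s) := by
  refine Nat.card_le_card_of_surjective (Quotient.map' id fun _ _ hxy => h hxy) ?_
  rintro ⟨x⟩
  exact ⟨Quotient.mk s x, rfl⟩

theorem card_quotient_joinSet [Finite V] (s : Setoid V) (T : Finset V) :
    Nat.card (Quotient (joinSet s (T : Set V))) + ((classes s T).card - 1)
      ≤ Nat.card (Quotient s) := by
  classical
  rcases T.eq_empty_or_nonempty with rfl | ⟨t, ht⟩
  · have h := card_quotient_le (le_joinSet s (((∅ : Finset V) : Set V)))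
    simpa [classes] using h
  set J := joinSet s (T : Set V) with hJ
  have := Fintype.ofFinite (Quotient s)
  have := Fintype.ofFinite (Quotient J)
  rw [Nat.card_eq_fintype_card, Nat.card_eq_fintype_card]
  -- Every class of `J` contains a class of `s`; for the merged class, take the class of `t`.
  let φ : Quotient J → Quotient s := fun q =>
    if q = Quotient.mk J t then Quotient.mk s t else Quotient.mk s q.out
  have hφ : ∀ q, φ q ∉ (classes s T).erase (Quotient.mk s t) := by
    intro q hq
    by_cases h : q = Quotient.mk J t
    · simp [φ, h] at hq
    · simp only [φ, h, if_false, Finset.mem_erase, mem_classes] at hq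
      obtain ⟨-, x, hx, hxq⟩ := hq
      refine h ?_
      rw [← Quotient.out_eq q]
      refine Quotient.sound (s := J) (Or.inr ⟨⟨x, hx, s.symm' (Quotient.exact hxq)⟩, t, ht, ?_⟩)
      exact s.refl' t
  have hinj : Function.Injective φ := by
    have hmk : ∀ q : Quotient J, ∀ x, φ q = Quotient.mk s x → q = Quotient.mk J x := by
      intro q x hx
      by_cases h : q = Quotient.mk J t
      · simp only [φ, h, if_true] at hx
        rw [h]
        exact Quotient.sound (s := J) (Or.inl (Quotient.exact hx))
      · simp only [φ, h, if_false] at hx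
        rw [← Quotient.out_eq q]
        exact Quotient.sound (s := J) (Or.inl (Quotient.exact hx))
    intro q q' h
    obtain ⟨x, hx⟩ := Quotient.exists_rep (φ q)
    rw [hmk q x hx.symm, hmk q' x (h ▸ hx.symm)]
  have hcard : Fintype.card (Quotient J)
      ≤ (Finset.univ \ (classes s T).erase (Quotient.mk s t)).card := by
    rw [← Finset.card_univ]
    exact Finset.card_le_card_of_injOn φ 
      (fun q _ => by simpa only [Finset.coe_sdiff, Finset.coe_univ, Set.mem_sdiff, Set.mem_univ,
        true_and, Finset.mem_coe] using hφ q) hinj.injOn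
  rw [Finset.card_sdiff_of_subset (Finset.subset_univ _), Finset.card_univ,
    Finset.card_erase_of_mem (mem_classes.2 ⟨t, ht, rfl⟩)] at hcard
  have := Finset.card_le_univ (classes s T)
  omega

/-- If the sets `T e` with `e ∈ D` form an acyclic hypergraph on the classes of `L`, then each of
them lowers the number of components by one less than the number of classes that it meets. -/
theorem sum_card_classes_le [Finite V] (T : E → Finset V) (L : Setoid V) (D : Finset E)
    (h : ∀ e ∈ D, ∀ x ∈ T e, ∀ y ∈ T e, ¬ L x y → ¬ glue T L ⊤ ((D : Set E) \ {e}) x y) :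
    ∑ e ∈ D, ((classes L (T e)).card - 1) + Nat.card (Quotient (glue T L ⊤ (D : Set E)))
      ≤ Nat.card (Quotient L) := by
  classical
  induction D using Finset.induction_on with
  | empty => simpa using card_quotient_le (le_glue (T := T) (L := L) (Q := ⊤) (D := ∅))
  | @insert f D hf ih =>
    have ih := ih fun e he x hx y hy hxy hglue =>
      h e (Finset.mem_insert_of_mem he) x hx y hy hxy
        (glue_mono le_rfl le_rfl (Set.sdiff_subset_sdiff_left (by simp)) hglue)
    have hle : joinSet (glue T L ⊤ (D : Set E)) (T f) ≤ glue T L ⊤ ((insert f D : Finset E)) := by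
      have hs : glue T L ⊤ (D : Set E) ≤ glue T L ⊤ ((insert f D : Finset E)) :=
        glue_mono le_rfl le_rfl (by simp)
      rintro x y (hxy | ⟨⟨a, ha, hxa⟩, b, hb, hyb⟩)
      · exact hs hxy
      · refine Setoid.trans' _ (hs hxa) (Setoid.trans' _ ?_ (Setoid.symm' _ (hs hyb)))
        exact glue_of_mem (by simp) ha hb trivial
    have h1 := card_quotient_le hle
    have h2 := card_quotient_joinSet (glue T L ⊤ (D : Set E)) (T f)
    have h3 : (classes L (T f)).card ≤ (classes (glue T L ⊤ (D : Set E)) (T f)).card := by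
      refine card_classes_mono fun x hx y hy hxy => ?_
      by_contra hL
      refine h f (by simp) x hx y hy hL (glue_mono le_rfl le_rfl ?_ hxy)
      intro g hg
      refine ⟨by simp [show g ∈ D from hg], ?_⟩
      rintro rfl; exact hf hg
    rw [Finset.sum_insert hf]
    omega

section core

variable [Fintype V] [Fintype E]

open scoped Classical in
/-- The set of the hyperedges that cross `X`. -/
noncomputable def boundary (inc : E → Finset V) (X : Finset V) : Finset E :=
  Finset.univ.filter fun e => (∃ x ∈ inc e, x ∈ X) ∧ ∃ x ∈ inc e, x ∉ X

variable {inc : E → Finset V}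

/-- A partition as provided by `exists_skeletal` has only one class, because otherwise there are too
few hyperedges crossing it. -/
theorem eq_top_of_skeletal [Nonempty V] (h3 : ∀ g, (inc g).card ≤ 3)
    (hcut : ∀ X : Finset V, X.Nonempty → X ≠ Finset.univ → 4 ≤ (boundary inc X).card ∧
      ∀ e ∈ boundary inc X, (inc e).card = 3 → 5 ≤ (boundary inc X).card)
    {π : E → Finset V} {F : Set E} {L : Setoid V} (hq : IsQuasi inc π) (hac : Acyclic π)
    (hconn : treeRefine F L π = L)
    (hcyc : ∀ C : Set E, (∀ g ∈ C, ∀ a ∈ π g, ∀ b ∈ π g, L a b) → ∀ e ∈ C, ∀ u ∈ inc e,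
      ∀ w ∈ inc e, ¬ L u w → ¬ glue inc L ⊤ (C \ {e}) u w) : L = ⊤ := by
  classical
  by_contra hL
  have := Fintype.ofFinite (Quotient L)
  set n := Nat.card (Quotient L) with hn
  set c : E → ℕ := fun e => (classes L (inc e)).card with hc
  have hc3 : ∀ e, c e ≤ 3 := fun e => card_classes_le.trans (h3 e)
  set C : Finset E := Finset.univ.filter fun e => ∀ a ∈ π e, ∀ b ∈ π e, L a b with hC
  set U : Finset E := Finset.univ.filter fun e => ¬ ∀ a ∈ π e, ∀ b ∈ π e, L a b with hU
  set U₃ : Finset E := U.filter fun e => c e = 3 with hU₃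
  set W : Finset (Quotient L) := U₃.biUnion fun e => classes L (inc e) with hW
  have hpos : ∀ r : Setoid V, 0 < Nat.card (Quotient r) := fun r =>
    have : Nonempty (Quotient r) := ⟨Quotient.mk r (Classical.arbitrary V)⟩
    Nat.card_pos
  -- The complement of `π` is acyclic on the classes.
  have h1 : ∑ e ∈ C, (c e - 1) + 1 ≤ n := by
    have hCs : ∀ g ∈ (C : Set E), ∀ a ∈ π g, ∀ b ∈ π g, L a b := fun g hg => by
      simpa [hC] using hg
    have h : ∑ e ∈ C, (c e - 1) + Nat.card (Quotient (glue inc L ⊤ (C : Set E))) ≤ n :=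
      sum_card_classes_le inc L C fun e he => hcyc C hCs e he
    have := hpos (glue inc L ⊤ (C : Set E))
    omega
  -- So is `π` itself, since it is connected on each class.
  have hind : ∀ D ⊆ U, ∀ e ∈ D, ∀ x ∈ π e, ∀ y ∈ π e, ¬ L x y →
      ¬ glue π L ⊤ ((D : Set E) \ {e}) x y := by
    intro D hD e he x hx y hy hxy hglue
    refine hac e x hx y hy (by rintro rfl; exact hxy (L.refl' _)) ?_
    refine (glue_le ?_ fun g hg a ha b hb _ => ?_ : glue π L ⊤ ((D : Set E) \ {e}) ≤ _) hglue
    · conv_lhs => rw [← hconn]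
      refine treeRefine_le_of fun g _ a ha b hb hab => ?_
      by_cases hge : g = e
      · subst hge
        rw [hq.eq_pair hx hy (by rintro rfl; exact hxy (L.refl' _))] at ha hb
        simp only [Finset.mem_insert, Finset.mem_singleton] at ha hb
        rcases ha with rfl | rfl <;> rcases hb with rfl | rfl
        exacts [Setoid.refl' _ _, (hxy hab).elim, (hxy (L.symm' hab)).elim, Setoid.refl' _ _]
      · exact glue_of_mem (D := ({e} : Set E)ᶜ) hge ha hb trivial
    · exact glue_of_mem (D := ({e} : Set E)ᶜ) hg.2 ha hb trivial
  have hcU : ∀ e ∈ U, 1 ≤ (classes L (π e)).card - 1 := by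
    intro e he
    simp only [hU, Finset.mem_filter, Finset.mem_univ, true_and] at he
    push Not at he
    obtain ⟨a, ha, b, hb, hab⟩ := he
    have : 1 < (classes L (π e)).card := Finset.one_lt_card.2
      ⟨_, mem_classes.2 ⟨a, ha, rfl⟩, _, mem_classes.2 ⟨b, hb, rfl⟩,
        fun h => hab (Quotient.exact h)⟩
    omega
  have h2 : U.card + 1 ≤ n := by
    have h := sum_card_classes_le π L U (hind U subset_rfl)
    have := hpos (glue π L ⊤ (U : Set E))
    have hs : U.card ≤ ∑ e ∈ U, ((classes L (π e)).card - 1) := by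
      simpa using Finset.card_nsmul_le_sum U _ 1 hcU
    omega
  have hU₃U : U₃ ⊆ U := Finset.filter_subset _ _
  have h3' : U₃.card ≤ W.card := by
    have h := sum_card_classes_le π L U₃ (hind U₃ hU₃U)
    have hs : U₃.card ≤ ∑ e ∈ U₃, ((classes L (π e)).card - 1) := by
      simpa using Finset.card_nsmul_le_sum U₃ _ 1 fun e he => hcU e (hU₃U he)
    -- The classes not in `W` remain isolated in the graph formed by the edges in `U₃`.
    have hle : glue π L ⊤ (U₃ : Set E) ≤ joinSet L {x | Quotient.mk L x ∈ W} := by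
      refine glue_le (le_joinSet _ _) fun g hg a ha b hb _ => joinSet_of_mem ?_ ?_
      all_goals
        refine Finset.mem_biUnion.2 ⟨g, hg, mem_classes.2 ⟨_, hq.subset g ?_, rfl⟩⟩
        assumption
    have := Fintype.ofFinite (Quotient (glue π L ⊤ (U₃ : Set E)))
    have hWc : (Finset.univ \ W).card ≤ Nat.card (Quotient (glue π L ⊤ (U₃ : Set E))) := by
      rw [Nat.card_eq_fintype_card, ← Finset.card_univ]
      refine Finset.card_le_card_of_injOn (fun q => Quotient.mk _ q.out) (fun _ _ => by simp) ?_
      intro p hp q _ hpq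
      rcases hle (Quotient.exact hpq) with h' | ⟨⟨x, hx, hpx⟩, -⟩
      · rw [← Quotient.out_eq p, ← Quotient.out_eq q]
        exact Quotient.sound h'
      · have : p = Quotient.mk L x := by
          rw [← Quotient.out_eq p]; exact Quotient.sound hpx
        rw [this] at hp
        simp at hp
        exact (hp hx).elim
    rw [Finset.card_sdiff_of_subset (Finset.subset_univ _), Finset.card_univ,
      ← Nat.card_eq_fintype_card] at hWc
    omega
  -- Counting incidences between classes and crossing hyperedges in two ways.
  set B : Finset E := Finset.univ.filter fun e => 2 ≤ c e with hB
  have hdeg : ∀ q : Quotient L, 4 + (if q ∈ W then 1 else 0)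
      ≤ (B.filter fun e => q ∈ classes L (inc e)).card := by
    intro q
    set X : Finset V := Finset.univ.filter fun x => Quotient.mk L x = q with hX
    have hXne : X.Nonempty := ⟨q.out, by simp [hX]⟩
    have hXuniv : X ≠ Finset.univ := by
      intro h
      refine hL (top_unique fun x y _ => ?_)
      have hx : ∀ x, Quotient.mk L x = q := fun x => by
        have : x ∈ X := h ▸ Finset.mem_univ x
        simpa [hX] using this
      exact Quotient.exact ((hx x).trans (hx y).symm)
    have hsub : boundary inc X ⊆ B.filter fun e => q ∈ classes L (inc e) := by
      intro e he
      simp only [boundary, Finset.mem_filter, Finset.mem_univ, true_and, hX] at he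
      obtain ⟨⟨x, hx, hxq⟩, y, hy, hyq⟩ := he
      simp only [hB, Finset.mem_filter, Finset.mem_univ, true_and]
      refine ⟨Finset.one_lt_card.2 ⟨_, mem_classes.2 ⟨x, hx, rfl⟩, _, mem_classes.2 ⟨y, hy, rfl⟩,
        fun h => hyq (h ▸ hxq)⟩, mem_classes.2 ⟨x, hx, hxq⟩⟩
    have hle := Finset.card_le_card hsub
    obtain ⟨h4, h5⟩ := hcut X hXne hXuniv
    by_cases hqW : q ∈ W
    · obtain ⟨e, he, hqe⟩ := Finset.mem_biUnion.1 hqW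
      have hce : c e = 3 := (Finset.mem_filter.1 he).2
      have hcard : (inc e).card = 3 :=
        le_antisymm (h3 e) (hce ▸ (card_classes_le : c e ≤ (inc e).card))
      obtain ⟨x, hx, hxq⟩ := mem_classes.1 hqe
      obtain ⟨p, hp, hpq⟩ := Finset.exists_mem_ne (s := classes L (inc e))
        (by change 1 < c e; omega) q
      obtain ⟨y, hy, hyp⟩ := mem_classes.1 hp
      have := h5 e (by
        simp only [boundary, Finset.mem_filter, Finset.mem_univ, true_and, hX]
        exact ⟨⟨x, hx, hxq⟩, y, hy, fun h => hpq (hyp ▸ h)⟩) hcard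
      simp only [hqW, if_true]
      omega
    · simp only [hqW, if_false]
      omega
  have hsum : ∑ q : Quotient L, (B.filter fun e => q ∈ classes L (inc e)).card = ∑ e ∈ B, c e := by
    have := Finset.sum_card_bipartiteAbove_eq_sum_card_bipartiteBelow
      (s := (Finset.univ : Finset (Quotient L))) (t := B) fun q e => q ∈ classes L (inc e)
    simpa [Finset.bipartiteAbove, Finset.bipartiteBelow, hc] using this
  have hlow : 4 * n + W.card ≤ ∑ e ∈ B, c e := by
    rw [← hsum]
    refine le_trans (le_of_eq ?_) (Finset.sum_le_sum fun q _ => hdeg q)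
    rw [Finset.sum_add_distrib, Finset.sum_ite_mem]
    simp [hn, mul_comm, Nat.card_eq_fintype_card]
  have hup : ∑ e ∈ B, c e ≤ 2 * ∑ e ∈ C, (c e - 1) + 2 * U.card + U₃.card := by
    have hpt : ∀ e ∈ B, c e ≤ (if e ∈ C then 2 * (c e - 1) else 0) + (if e ∈ U then 2 else 0)
        + (if e ∈ U₃ then 1 else 0) := by
      intro e he
      have h2c : 2 ≤ c e := (Finset.mem_filter.1 he).2
      have h3c := hc3 e
      by_cases hCe : ∀ a ∈ π e, ∀ b ∈ π e, L a b
      · have : e ∈ C := by simpa [hC] using hCe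
        simp only [this, if_true]
        omega
      · have heU : e ∈ U := by
          simp only [hU, Finset.mem_filter, Finset.mem_univ, true_and]; exact hCe
        simp only [hU₃, Finset.mem_filter, heU, true_and, if_true]
        split_ifs <;> omega
    refine (Finset.sum_le_sum hpt).trans
      ((Finset.sum_le_sum_of_subset (Finset.subset_univ B)).trans (le_of_eq ?_))
    rw [Finset.sum_add_distrib, Finset.sum_add_distrib, Finset.sum_ite_mem, Finset.sum_ite_mem,
      Finset.sum_ite_mem]
    simp [Finset.mul_sum, mul_comm]
  omega

/-- The theorem in terms of partitions: there is a tree `π` such that every nontrivial partition is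
crossed by a hyperedge `e` with `π e` inside one of the classes. -/
theorem exists_anticonnected_tree [Nonempty V] (h3 : ∀ g, (inc g).card ≤ 3)
    (hcut : ∀ X : Finset V, X.Nonempty → X ≠ Finset.univ → 4 ≤ (boundary inc X).card ∧
      ∀ e ∈ boundary inc X, (inc e).card = 3 → 5 ≤ (boundary inc X).card) :
    ∃ π : E → Finset V, IsQuasi inc π ∧ Acyclic π ∧ glue π ⊥ ⊤ Set.univ = ⊤ ∧
      ∀ R : Setoid V, R ≠ ⊤ → ∃ e, (∃ x ∈ inc e, ∃ y ∈ inc e, ¬ R x y) ∧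
        ∀ a ∈ π e, ∀ b ∈ π e, R a b := by
  obtain ⟨π, F, L, hq, hac, hconn, hanti, hcyc⟩ := exists_skeletal inc h3
  obtain rfl := eq_top_of_skeletal h3 hcut hq hac hconn hcyc
  refine ⟨π, hq, hac, top_unique ?_, fun R hR => ?_⟩
  · have h : treeRefine F ⊤ π ≤ glue π ⊥ ⊤ Set.univ :=
      glue_mono le_rfl le_rfl (Set.subset_univ _)
    rwa [hconn] at h
  · by_contra! hcon
    refine hR (top_unique ?_)
    rw [← hanti]
    refine AntiClosed.antiRefine_le ⟨le_top, fun g _ x hx y hy _ _ hab => ?_⟩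
    by_contra hxy
    obtain ⟨a, ha, b, hb, hnab⟩ := hcon g ⟨x, hx, y, hy, hxy⟩
    exact hnab (hab a ha b hb)

end core

end QuasitreePacking

/-! ### Tight complements -/

namespace Quasigraph

open scoped Classical in
/-- The class of `w` with respect to an equivalence relation on a finite set `S` of vertices. -/
noncomputable def classOf {V : Type*} {S : Finset V} (R : Setoid {v // v ∈ S}) (w : {v // v ∈ S}) :
    Finset V :=
  (S.attach.filter fun v => R v w).map (Function.Embedding.subtype _)

theorem mem_classOf {V : Type*} {S : Finset V} {R : Setoid {v // v ∈ S}} {w : {v // v ∈ S}}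
    {v : V} : v ∈ classOf R w ↔ ∃ h : v ∈ S, R ⟨v, h⟩ w := by
  simp [classOf]

variable {V E : Type*} [DecidableEq V] [DecidableEq E]

/-- Whether `π` has tight complement in `H` depends only on the values at the hyperedges of `H`. -/
theorem HasTightComplement.congr {H : ThreeHypergraph V E} {π : Quasigraph H}
    (h : HasTightComplement H π) {H' : ThreeHypergraph V E} {π' : Quasigraph H'}
    (hverts : H'.verts = H.verts) (hedges : H'.edges = H.edges)
    (hinc : ∀ e ∈ H.edges, H'.inc e = H.inc e) (hrep : ∀ e ∈ H.edges, π'.rep e = π.rep e) :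
    HasTightComplement H' π' := by
  induction h generalizing H' with
  | of_connected H π h =>
    refine .of_connected _ _ fun X hX hne => ?_
    obtain ⟨e, he, h1, h2⟩ := h X (by simpa [complement, ThreeHypergraph.deleteEdges, hverts]
      using hX) hne
    have heE : e ∈ H.edges := (Finset.mem_sdiff.1 he).1
    refine ⟨e, ?_, ?_, ?_⟩
    · simp only [complement, ThreeHypergraph.deleteEdges, used, Finset.mem_sdiff,
        Finset.mem_filter, hedges] at he ⊢
      rwa [hrep e heE]
    · simpa [complement, ThreeHypergraph.deleteEdges, hinc e heE] using h1
    · simpa [complement, ThreeHypergraph.deleteEdges, hinc e heE, hverts] using h2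
  | of_partition H π X₁ X₂ hunion hdisj hne₁ hne₂ h₁ h₂ hlink ih₁ ih₂ =>
    have hsec : ∀ X, (π'.sectionAt X).edges = (π.sectionAt X).edges := by
      intro X
      simp only [sectionAt, hedges]
      refine Finset.filter_congr fun e he => ?_
      rw [hinc e he, hrep e he]
    have hmem : ∀ X, ∀ e ∈ (π.sectionAt X).edges, e ∈ H.edges := fun X e he =>
      (Finset.mem_filter.1 he).1
    obtain ⟨e, he, h1, h2⟩ := hlink
    have heE : e ∈ H.edges := (Finset.mem_filter.1 he).1
    refine .of_partition _ _ X₁ X₂ (hunion.trans hverts.symm) hdisj hne₁ hne₂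
      (ih₁ rfl (hsec X₁) (fun e he => ?_) fun e he => hrep e (hmem _ e he))
      (ih₂ rfl (hsec X₂) (fun e he => ?_) fun e he => hrep e (hmem _ e he))
      ⟨e, ?_, by rwa [hrep e heE], by rwa [hinc e heE]⟩
    · simp only [sectionAt, hinc e (hmem _ e he)]
    · simp only [sectionAt, hinc e (hmem _ e he)]
    · simp only [used, Finset.mem_filter, hedges] at he ⊢
      rwa [hrep e heE]

variable {H : ThreeHypergraph V E} {π : Quasigraph H}

/-- The `π`-section at a subset of `X` can be taken inside the `π`-section at `X`. -/
theorem HasTightComplement.induce_induce {X Y : Finset V} (hY : Y ⊆ X)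
    (h : HasTightComplement (π.sectionAt Y) (π.induce Y)) :
    HasTightComplement ((π.induce X).sectionAt Y) ((π.induce X).induce Y) := by
  have hinc : ∀ e, H.inc e ∩ X ∩ Y = H.inc e ∩ Y := fun e => by
    rw [Finset.inter_assoc, Finset.inter_eq_right.2 hY]
  refine h.congr rfl ?_ (fun e _ => hinc e) fun _ _ => rfl
  ext e
  simp only [sectionAt, induce, Finset.mem_filter, hinc]
  constructor
  · rintro ⟨⟨h1, -, -⟩, h2, h3⟩
    exact ⟨h1, h2, h3⟩
  · rintro ⟨h1, h2, h3⟩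
    exact ⟨⟨h1, h2.trans (Finset.card_le_card (Finset.inter_subset_inter_left hY)),
      h3.trans hY⟩, h2, h3⟩

theorem HasTightComplement.union {X Y : Finset V} (hdisj : Disjoint X Y) (hY : Y.Nonempty)
    (hX : HasTightComplement (π.sectionAt X) (π.induce X))
    (hY' : HasTightComplement (π.sectionAt Y) (π.induce Y)) {e : E} (he : e ∈ H.edges)
    (hne : π.rep e ≠ ∅) (hrep : π.rep e ⊆ X) (hinc : (H.inc e ∩ Y).Nonempty) :
    HasTightComplement (π.sectionAt (X ∪ Y)) (π.induce (X ∪ Y)) := by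
  have hXY : π.rep e ⊆ X ∪ Y := hrep.trans Finset.subset_union_left
  refine .of_partition _ _ X Y rfl hdisj ((Finset.nonempty_iff_ne_empty.2 hne).mono hrep) hY
    (hX.induce_induce Finset.subset_union_left) (hY'.induce_induce Finset.subset_union_right)
    ⟨e, ?_, hrep, ?_⟩
  · refine Finset.mem_filter.2 ⟨Finset.mem_filter.2 ⟨he, ?_, hXY⟩, hne⟩
    rw [← (π.card_rep e he).resolve_left hne]
    exact Finset.card_le_card (Finset.subset_inter (π.rep_subset e he) hXY)
  · obtain ⟨z, hz⟩ := hinc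
    rw [Finset.mem_inter] at hz
    exact ⟨z, by simp [sectionAt, hz.1, hz.2]⟩

/-- The complement of `π` is connected on each of its components. -/
theorem hasTightComplement_component {R : Setoid {v // v ∈ H.verts}}
    (hR : R = sInf {R | ∀ e ∈ H.edges, π.rep e = ∅ →
      ∀ x y : {v // v ∈ H.verts}, x.1 ∈ H.inc e → y.1 ∈ H.inc e → R x y})
    (w : {v // v ∈ H.verts}) :
    HasTightComplement (π.sectionAt (classOf R w)) (π.induce (classOf R w)) := by
  have hmem : ∀ e ∈ H.edges, π.rep e = ∅ →
      ∀ x y : {v // v ∈ H.verts}, x.1 ∈ H.inc e → y.1 ∈ H.inc e → R x y := by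
    rw [hR]
    exact fun e he h0 x y hx hy => Setoid.sInf_iff.2 fun S hS => hS e he h0 x y hx hy
  refine .of_connected _ _ fun Y hY hne => ?_
  change Y ⊂ classOf R w at hY
  by_contra! hcon
  -- Otherwise `R` could be refined by separating `Y` from the rest of the component.
  let S : Setoid {v // v ∈ H.verts} :=
    { r := fun x y => R x y ∧ (x.1 ∈ Y ↔ y.1 ∈ Y)
      iseqv := ⟨fun x => ⟨R.refl' x, Iff.rfl⟩, fun h => ⟨R.symm' h.1, h.2.symm⟩,
        fun h h' => ⟨R.trans' h.1 h'.1, h.2.trans h'.2⟩⟩ }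
  have hstep : ∀ e ∈ H.edges, π.rep e = ∅ → ∀ x y : {v // v ∈ H.verts}, x.1 ∈ H.inc e →
      y.1 ∈ H.inc e → x.1 ∈ Y → y.1 ∈ Y := by
    intro e he h0 x y hx hy hxY
    by_contra hyY
    have hxw := mem_classOf.1 (hY.1 hxY)
    have hxc : x.1 ∈ classOf R w := hY.1 hxY
    have hyc : y.1 ∈ classOf R w :=
      mem_classOf.2 ⟨y.2, R.trans' (hmem e he h0 y x hy hx) hxw.2⟩
    have h := hcon e ?_ ⟨x.1, by
      simp [complement, ThreeHypergraph.deleteEdges, sectionAt, hx, hxc, hxY]⟩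
    · have : y.1 ∈ (∅ : Finset V) := by
        rw [← h]
        simp [complement, ThreeHypergraph.deleteEdges, sectionAt, hy, hyc, hyY]
      simp at this
    · have h2 : 1 < (H.inc e ∩ classOf R w).card := Finset.one_lt_card.2
        ⟨x.1, by simp [hx, hxc], y.1, by simp [hy, hyc], fun h => hyY (h ▸ hxY)⟩
      exact Finset.mem_sdiff.2 ⟨Finset.mem_filter.2 ⟨he, h2, by simp [h0]⟩,
        fun h => (Finset.mem_filter.1 h).2 h0⟩
  have hRS : R ≤ S := by
    conv_lhs => rw [hR]
    refine sInf_le fun e he h0 x y hx hy => ⟨hmem e he h0 x y hx hy, ?_⟩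
    exact ⟨hstep e he h0 x y hx hy, hstep e he h0 y x hy hx⟩
  obtain ⟨y, hy⟩ := hne
  obtain ⟨hyH, hyw⟩ := mem_classOf.1 (hY.1 hy)
  refine hY.2 fun z hz => ?_
  obtain ⟨hzH, hzw⟩ := mem_classOf.1 hz
  exact (hRS (R.trans' hzw (R.symm' hyw)) : S ⟨z, hzH⟩ ⟨y, hyH⟩).2.2 hy

open QuasitreePacking in
/-- A quasigraph has tight complement if every nontrivial partition of the vertex set is crossed by
a hyperedge `e` with `π e` inside one of the classes: the components of the complement can then be
merged one after the other. -/
theorem hasTightComplement_of_partitions (hV : H.verts.Nonempty)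
    (h : ∀ R : Setoid {v // v ∈ H.verts}, R ≠ ⊤ → ∃ e ∈ H.edges,
      (∃ x y : {v // v ∈ H.verts}, x.1 ∈ H.inc e ∧ y.1 ∈ H.inc e ∧ ¬ R x y) ∧
        ∀ a b : {v // v ∈ H.verts}, a.1 ∈ π.rep e → b.1 ∈ π.rep e → R a b) :
    HasTightComplement H π := by
  have := finite_setoid (V := {v // v ∈ H.verts})
  obtain ⟨R₀, hR₀⟩ : ∃ R₀, R₀ = sInf {R : Setoid {v // v ∈ H.verts} | ∀ e ∈ H.edges, π.rep e = ∅ →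
      ∀ x y : {v // v ∈ H.verts}, x.1 ∈ H.inc e → y.1 ∈ H.inc e → R x y} := ⟨_, rfl⟩
  obtain ⟨R, ⟨hR₀R, htight⟩, hmax⟩ := (Set.toFinite {R : Setoid {v // v ∈ H.verts} | R₀ ≤ R ∧
    ∀ w, HasTightComplement (π.sectionAt (classOf R w)) (π.induce (classOf R w))}).exists_maximal
    ⟨R₀, le_rfl, hasTightComplement_component hR₀⟩
  obtain ⟨v, hv⟩ := hV
  by_cases hR : R = ⊤
  · have hcl : classOf R ⟨v, hv⟩ = H.verts := by
      ext z; rw [mem_classOf, hR]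
      exact ⟨fun h => h.1, fun h => ⟨h, trivial⟩⟩
    have ht := htight ⟨v, hv⟩
    rw [hcl] at ht
    have hinc : ∀ e ∈ H.edges, H.inc e ∩ H.verts = H.inc e := fun e he =>
      Finset.inter_eq_left.2 (H.inc_subset e he)
    refine ht.congr rfl ?_ (fun e he => (hinc e (Finset.mem_filter.1 he).1).symm) fun _ _ => rfl
    refine (Finset.filter_true_of_mem fun e he => ⟨?_, ?_⟩).symm
    · rw [hinc e he]
      rcases H.card_inc e he with h | h <;> omega
    · exact (π.rep_subset e he).trans (H.inc_subset e he)
  · exfalso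
    obtain ⟨e, he, ⟨x, y, hx, hy, hxy⟩, hrep⟩ := h R hR
    have hne : π.rep e ≠ ∅ := fun h0 => hxy (hR₀R (by
      rw [hR₀]
      exact Setoid.sInf_iff.2 fun S hS => hS e he h0 x y hx hy))
    obtain ⟨a, ha⟩ := Finset.nonempty_iff_ne_empty.2 hne
    have haH : a ∈ H.verts := H.inc_subset e he (π.rep_subset e he ha)
    obtain ⟨c, hc, hac⟩ : ∃ c : {v // v ∈ H.verts}, c.1 ∈ H.inc e ∧ ¬ R c ⟨a, haH⟩ := by
      by_cases hxa : R x ⟨a, haH⟩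
      · exact ⟨y, hy, fun hya => hxy (R.trans' hxa (R.symm' hya))⟩
      · exact ⟨x, hx, hxa⟩
    -- The classes of `a` and `c` are merged.
    have hdisj : Disjoint (classOf R ⟨a, haH⟩) (classOf R c) := by
      refine Finset.disjoint_left.2 fun z hz hz' => hac ?_
      obtain ⟨hz1, hza⟩ := mem_classOf.1 hz
      obtain ⟨_, hzc⟩ := mem_classOf.1 hz'
      exact R.trans' (R.symm' hzc) hza
    have hcc : c.1 ∈ classOf R c := mem_classOf.2 ⟨c.2, R.refl' c⟩
    have hunion := HasTightComplement.union hdisj ⟨c.1, hcc⟩ (htight ⟨a, haH⟩) (htight c) he hne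
      (fun b hb => mem_classOf.2 ⟨H.inc_subset e he (π.rep_subset e he hb),
        hrep ⟨b, _⟩ ⟨a, haH⟩ hb ha⟩) ⟨c.1, Finset.mem_inter.2 ⟨hc, hcc⟩⟩
    refine hac ((hmax (y := joinSet R {⟨a, haH⟩, c}) ⟨hR₀R.trans (le_joinSet _ _), fun w => ?_⟩
      (le_joinSet _ _)) (joinSet_of_mem (by simp) (by simp)))
    by_cases hw : R w ⟨a, haH⟩ ∨ R w c
    · have hcl : classOf (joinSet R {⟨a, haH⟩, c}) w
          = classOf R ⟨a, haH⟩ ∪ classOf R c := by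
        ext z
        simp only [mem_classOf, Finset.mem_union, joinSet_apply, Set.mem_insert_iff,
          Set.mem_singleton_iff, exists_eq_or_imp, exists_eq_left]
        constructor
        · rintro ⟨hz, hzw | ⟨hz', -⟩⟩
          · rcases hw with hw | hw
            · exact Or.inl ⟨hz, R.trans' hzw hw⟩
            · exact Or.inr ⟨hz, R.trans' hzw hw⟩
          · exact hz'.imp (fun h => ⟨hz, h⟩) fun h => ⟨hz, h⟩
        · rintro (⟨hz, hz'⟩ | ⟨hz, hz'⟩)
          · exact ⟨hz, Or.inr ⟨Or.inl hz', hw⟩⟩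
          · exact ⟨hz, Or.inr ⟨Or.inr hz', hw⟩⟩
      rw [hcl]
      exact hunion
    · have hcl : classOf (joinSet R {⟨a, haH⟩, c}) w = classOf R w := by
        ext z
        simp only [mem_classOf, joinSet_apply, Set.mem_insert_iff,
          Set.mem_singleton_iff, exists_eq_or_imp, exists_eq_left]
        constructor
        · rintro ⟨hz, hzw | ⟨-, hw'⟩⟩
          · exact ⟨hz, hzw⟩
          · exact (hw hw').elim
        · rintro ⟨hz, hz'⟩
          exact ⟨hz, Or.inl hz'⟩
      rw [hcl]
      exact htight w

end Quasigraph

/-! ### The theorem -/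

namespace ThreeHypergraph

variable {V E : Type*} [DecidableEq V] [DecidableEq E]

/-- A set of hyperedges whose removal disconnects `H` contains an edge-cut. -/
theorem exists_isEdgeCut_subset {H : ThreeHypergraph V E} {B : Finset E} (hB : B ⊆ H.edges)
    (h : ¬ (H.deleteEdges B).Connected) : ∃ F ⊆ B, H.IsEdgeCut F := by
  obtain ⟨F, hF, hmin⟩ := exists_minimal_le_of_wellFoundedLT
    (fun F' : Finset E => F' ⊆ H.edges ∧ ¬ (H.deleteEdges F').Connected) B ⟨hB, h⟩
  exact ⟨F, hF, hmin⟩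

end ThreeHypergraph

open QuasitreePacking Quasigraph in
theorem theoremt {V E : Type*} [DecidableEq V] [DecidableEq E] (H : ThreeHypergraph V E)
    (hV : H.verts.Nonempty) (hconn : H.EdgeConnected 4)
    (hcut : ∀ F : Finset E, H.IsEdgeCut F → F.card = 4 → ∀ e ∈ F, (H.inc e).card ≠ 3) :
    ∃ π : Quasigraph H, π.IsQuasitree ∧ Quasigraph.HasTightComplement H π := by
  classical
  let W := {v // v ∈ H.verts}
  let I := {e // e ∈ H.edges}
  let ι : W ↪ V := Function.Embedding.subtype _
  let inc : I → Finset W := fun e => (H.inc e).subtype (· ∈ H.verts)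
  have : Nonempty W := ⟨⟨hV.choose, hV.choose_spec⟩⟩
  have hmap : ∀ e : I, (inc e).map ι = H.inc e := fun e =>
    Finset.subtype_map_of_mem fun x hx => H.inc_subset e e.2 hx
  have hmem : ∀ (e : I) (x : W), x ∈ inc e ↔ x.1 ∈ H.inc e := fun e x => Finset.mem_subtype
  have hcard : ∀ e : I, (inc e).card = (H.inc e).card := fun e => by
    rw [← hmap e, Finset.card_map]
  have h3 : ∀ e, (inc e).card ≤ 3 := fun e => by
    rw [hcard]; rcases H.card_inc e e.2 with h | h <;> omega
  have hbd : ∀ X : Finset W, X.Nonempty → X ≠ Finset.univ → 4 ≤ (boundary inc X).card ∧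
      ∀ e ∈ boundary inc X, (inc e).card = 3 → 5 ≤ (boundary inc X).card := by
    intro X hX hXu
    set B : Finset E := (boundary inc X).map (Function.Embedding.subtype _) with hB
    have hBcard : B.card = (boundary inc X).card := Finset.card_map _
    have hBE : B ⊆ H.edges := by
      intro e he
      obtain ⟨e', -, rfl⟩ := Finset.mem_map.1 he
      exact e'.2
    have hdisc : ¬ (H.deleteEdges B).Connected := by
      intro hc
      have hsub : X.map ι ⊆ H.verts := by
        intro x hx
        obtain ⟨x', -, rfl⟩ := Finset.mem_map.1 hx
        exact x'.2
      have hss : ¬ H.verts ⊆ X.map ι := by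
        refine fun hsup => hXu (Finset.eq_univ_of_forall fun z => ?_)
        obtain ⟨z', hz', heq⟩ := Finset.mem_map.1 (hsup z.2)
        exact ι.injective heq ▸ hz'
      obtain ⟨e, he, ⟨x, hx⟩, y, hy⟩ := hc (X.map ι) ⟨hsub, hss⟩ hX.map
      obtain ⟨heE, heB⟩ := Finset.mem_sdiff.1 he
      rw [Finset.mem_inter] at hx hy
      obtain ⟨x', hx', rfl⟩ := Finset.mem_map.1 hx.2
      obtain ⟨hyH, hyX⟩ := Finset.mem_sdiff.1 hy.2
      refine heB (Finset.mem_map.2 ⟨⟨e, heE⟩, ?_, rfl⟩)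
      simp only [boundary, Finset.mem_filter, Finset.mem_univ, true_and]
      exact ⟨⟨x', (hmem _ _).2 hx.1, hx'⟩, ⟨y, hyH⟩, (hmem _ _).2 hy.1,
        fun h => hyX (Finset.mem_map.2 ⟨_, h, rfl⟩)⟩
    obtain ⟨F, hFB, hF⟩ := ThreeHypergraph.exists_isEdgeCut_subset hBE hdisc
    have h4 := hconn.2 F hF
    have hle := Finset.card_le_card hFB
    refine ⟨by omega, fun e he he3 => ?_⟩
    by_contra hlt
    obtain rfl : F = B := Finset.eq_of_subset_of_card_le hFB (by omega)
    exact hcut _ hF (by omega) e (Finset.mem_map.2 ⟨e, he, rfl⟩) (hcard e ▸ he3)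
  obtain ⟨π, hq, hac, hspan, hanti⟩ := exists_anticonnected_tree h3 hbd
  have hrep : ∀ (e : E) (he : e ∈ H.edges),
      (if h : e ∈ H.edges then (π ⟨e, h⟩).map ι else ∅) = (π ⟨e, he⟩).map ι := fun e he =>
    dif_pos he
  let ρ : Quasigraph H :=
    { rep := fun e => if h : e ∈ H.edges then (π ⟨e, h⟩).map ι else ∅
      rep_subset := fun e he => by
        rw [hrep e he, ← hmap ⟨e, he⟩]
        exact Finset.map_subset_map.2 (hq.subset _)
      card_rep := fun e he => by
        rw [hrep e he, Finset.card_map, Finset.map_eq_empty]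
        exact hq.card _ }
  have hρ : ∀ e : I, ρ.rep e = (π e).map ι := fun e => hrep e e.2
  have hρmem : ∀ (e : I) (x : W), x.1 ∈ ρ.rep e ↔ x ∈ π e := fun e x => by
    rw [hρ]
    exact Finset.mem_map' ι
  have hpair : ∀ (e : I) (x y : W), ρ.rep e = {x.1, y.1} → x ∈ π e ∧ y ∈ π e := fun e x y h => by
    rw [← hρmem, ← hρmem, h]; simp
  refine ⟨ρ, ⟨?_, ?_, ?_⟩, ?_⟩
  · intro e he f hf hef
    obtain ⟨heE, hne⟩ := Finset.mem_filter.1 he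
    obtain ⟨hfE, -⟩ := Finset.mem_filter.1 hf
    by_contra hne'
    have hπ : π ⟨e, heE⟩ = π ⟨f, hfE⟩ :=
      Finset.map_injective ι (by rw [← hρ ⟨e, heE⟩, ← hρ ⟨f, hfE⟩]; exact hef)
    have hne0 : π ⟨e, heE⟩ ≠ ∅ := fun h0 => hne (by rw [hρ ⟨e, heE⟩, h0, Finset.map_empty])
    obtain ⟨a, ha⟩ := Finset.nonempty_iff_ne_empty.2 hne0
    obtain ⟨b, hb, hab⟩ := hq.pair ha
    refine hac _ a ha b hb hab (glue_of_mem (g := ⟨f, hfE⟩) ?_ (hπ ▸ ha) (hπ ▸ hb) trivial)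
    exact fun h => hne' (congrArg Subtype.val h).symm
  · refine (SimpleGraph.connected_iff_exists_forall_reachable _).2
      ⟨Classical.arbitrary W, fun w => ?_⟩
    have hle : glue π ⊥ ⊤ Set.univ ≤ ρ.starGraph.reachableSetoid := by
      refine glue_le bot_le fun g _ a ha b hb _ => ?_
      by_cases hab : a = b
      · subst hab; exact Setoid.refl' _ _
      · refine SimpleGraph.Adj.reachable (G := ρ.starGraph) ⟨hab, g.1, g.2, ?_⟩
        rw [hρ, hq.eq_pair ha hb hab, Finset.map_insert, Finset.map_singleton]
        rfl
    rw [hspan] at hle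
    exact hle trivial
  · refine SimpleGraph.isAcyclic_iff_forall_adj_isBridge.2 fun v w hvw => ?_
    obtain ⟨hne, e, he, hev⟩ := hvw
    rw [SimpleGraph.isBridge_iff]
    intro hreach
    obtain ⟨hv, hw⟩ := hpair ⟨e, he⟩ v w hev
    refine hac ⟨e, he⟩ v hv w hw hne ?_
    have key : ∀ x y : W, (ρ.starGraph.deleteEdges {s(v, w)}).Walk x y →
        glue π ⊥ ⊤ {⟨e, he⟩}ᶜ x y := by
      intro x y p
      induction p with
      | nil => exact Setoid.refl' _ _
      | @cons x y _ hadj p ih =>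
        rw [SimpleGraph.deleteEdges_adj] at hadj
        obtain ⟨⟨hxy, f, hf, hfxy⟩, hne'⟩ := hadj
        obtain ⟨hx, hy⟩ := hpair ⟨f, hf⟩ _ _ hfxy
        have hfe : (⟨f, hf⟩ : I) ∈ ({⟨e, he⟩} : Set I)ᶜ := by
          intro hfe
          rw [Set.mem_singleton_iff.1 hfe, hq.eq_pair hv hw hne] at hx hy
          simp only [Finset.mem_insert, Finset.mem_singleton] at hx hy
          refine hne' (Set.mem_singleton_iff.2 ?_)
          rcases hx with rfl | rfl <;> rcases hy with rfl | rfl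
          exacts [(hxy rfl).elim, rfl, Sym2.eq_swap, (hxy rfl).elim]
        exact Setoid.trans' _ (glue_of_mem hfe hx hy trivial) ih
    exact hreach.elim fun p => key v w p
  · refine hasTightComplement_of_partitions hV fun R hR => ?_
    obtain ⟨e, ⟨x, hx, y, hy, hxy⟩, hab⟩ := hanti R hR
    exact ⟨e.1, e.2, ⟨x, y, (hmem e x).1 hx, (hmem e y).1 hy, hxy⟩, fun a b ha hb =>
      hab a ((hρmem e a).1 ha) b ((hρmem e b).1 hb)⟩
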